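/- **Setting.** Let $V$ be a finite, linearly ordered vocabulary, let $\mathrm{LLM}$ assign to each prompt a probability vector on $V$, and let $PB$ build a prompt from a (possibly empty) list of labelled examples, a label, and the tokens generated so far. The parameters are integers $T_{\max},\hat T\ge 0$, $M,N\ge 1$, $1\le K\le |V|$ and reals $\rho\in(0,1]$, $\mu$, $\lambda\ge 0$, $\theta>0$, $\sigma_0,\sigma_1,\sigma_2>0$. Fix a label $\tilde y$ and integers $n$ and $n_0\ge MN$. Inputs are datasets of $n$ labelled examples $(x,y)$, at least $n_0$ of which have label $\tilde y$. Two datasets are neighbors if they differ in a single entry. Put $t=\lceil\rho M\rceil$ and $k_\theta=\max\bigl(0,\lceil\log_2(\sqrt2/(2\theta))\rceil\bigr)$. **AdaDPSyn.** Start with $\tilde x=[\,]$ and repeat $T_{\max}$ times, with fresh randomness each time: 1. *Next token generation.* Draw $MN$ examples with label $\tilde y$ from the dataset uniformly at random, in random order and without replacement, and split them into $M$ consecutive blocks of size $N$. Let $S$ be the $K$ tokens most probable under $\mathrm{LLM}$ on the prompt with no examples, with label $\tilde y$ and tokens $\tilde x$. Let $p^i\in\mathbb R^S$ be the $\mathrm{LLM}$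 probability vector for the prompt with the $i$-th block, label $\tilde y$ and tokens $\tilde x$, restricted to $S$ and rescaled to sum $1$. 2. *GoodRadius.* For $s\ge 0$ let $B_s(p)=\#\{i:\|p^i-p\|_2\le s\}$ and $L(s)=\frac1t\max_{i_1,\dots,i_t\text{ distinct}}\sum_k\min\{B_s(p^{i_k}),t\}$. Start with $[r_{\rm low},r_{\rm high}]=[0,\sqrt2/2]$. While $r_{\rm high}-r_{\rm low}>\theta$, let $r_{\rm mid}$ be the midpoint and draw independent $a\sim\mathcal N(L(r_{\rm mid}),4\sigma_0^2)$ and $b\sim\mathcal N(L(r_{\rm mid}/2),4\sigma_0^2)$; if $b\ge t$ or $a\ge t$, set $r_{\rm high}=r_{\rm mid}$, and otherwise set $r_{\rm low}=r_{\rm mid}$. Let $r=(r_{\rm low}+r_{\rm high})/2$ at the end. 3. *Radius reduction.* For $p\in\mathbb R^S$ let $\Pi(p)=\max(p,0)/\|\max(p,0)\|_1$. Set $R=\sqrt2/2$ and $\tilde p=\Pi\bigl(\frac1M(\sum_i p^i+\mathcal N(0,4R^2\sigma_1^2I))\bigr)$. Then at most $\hat T$ times: put $R'=r+2\lambda R\sigma_1\sqrt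 K/M$ and stop if $\#\{i:\|p^i-\tilde p\|_2\le R'\}+\mathcal N(0,\sigma_2^2)<\mu M$ or if $R<R'$. Otherwise set $R=R'$, let $\tilde p^i=\tilde p+(p^i-\tilde p)/\max(1,\|p^i-\tilde p\|_2/R)$, and replace $\tilde p$ by $\Pi\bigl(\frac1M(\sum_i\tilde p^i+\mathcal N(0,4R^2\sigma_1^2I))\bigr)$. 4. Append $\arg\max_{j\in S}\tilde p[j]$ to $\tilde x$. The output is $\tilde x$. Ties in the choice of $S$ and in the $\arg\max$ go to the smaller token; a quotient with denominator $0$ (in the rescaling or in $\Pi$) is read as $0$. **Theorem.** For integers $j\ge2$ put $$\tau(j)=\frac{j\,k_\theta}{\sigma_0^2}+(\hat T+1)\frac{j}{2\sigma_1^2}+\hat T\frac{j}{2\sigma_2^2},\qquad \gamma=\frac{MN}{n_0},$$ $$\tau'(\alpha)=\frac1{\alpha-1}\log\Bigl(1+\gamma^2\tbinom\alpha2\min\{4(e^{\tau(2)}-1),2e^{\tau(2)}\}+\sum_{j=3}^{\alpha}2\gamma^j\tbinom\alpha j e^{(j-1)\tau(j)}\Bigr).$$ Then the law of the output of AdaDPSyn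 is a probability measure on token sequences, and for every integer $\alpha\ge2$ and every $\delta\in(0,1)$, AdaDPSyn is $(\varepsilon,\delta)$-differentially private with $$\varepsilon=T_{\max}\,\tau'(\alpha)+\log\frac{\alpha-1}{\alpha}-\frac{\log\delta+\log\alpha}{\alpha-1},$$ that is, $\mathbb P[A(D)\in E]\le e^{\varepsilon}\,\mathbb P[A(D')\in E]+\delta$ for all neighboring $D,D'$ and all sets $E$ of token sequences. -/

import Mathlib

open MeasureTheory ProbabilityTheory
open scoped ENNReal

noncomputable section

namespace AdaDPSyn

/-! ### Differential privacy -/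

/-- A randomized algorithm `A`, sending an input `D` to the law `A D` of its output, is
`(ε, δ)`-differentially private for the neighboring relation `Nbr` on inputs. -/
def IsDP {𝓓 Ω : Type*} [MeasurableSpace Ω] (Nbr : 𝓓 → 𝓓 → Prop) (A : 𝓓 → Measure Ω)
    (ε δ : ℝ) : Prop :=
  ∀ D D' : 𝓓, Nbr D D' → ∀ S : Set Ω, MeasurableSet S →
    A D S ≤ ENNReal.ofReal (Real.exp ε) * A D' S + ENNReal.ofReal δ

/-- Datasets of `n` labelled examples `(x, y)` of which at least `n₀` carry the label `y`. -/
def Dataset (X Y : Type*) [DecidableEq Y] (n : ℕ) (y : Y) (n₀ : ℕ) : Type _ :=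
  {D : Fin n → X × Y // n₀ ≤ (Finset.univ.filter fun i => (D i).2 = y).card}

/-- Two datasets are neighbors if they differ in at most one entry (whose example and label may
both change). -/
def Neighbor {X Y : Type*} [DecidableEq Y] {n : ℕ} {y : Y} {n₀ : ℕ}
    (D D' : Dataset X Y n y n₀) : Prop :=
  ∃ i, ∀ j, j ≠ i → D.1 j = D'.1 j

/-! ### Parameters -/

/-- The numerical inputs of the algorithm. -/
structure Params where
  /-- `T_max`, the number of tokens to generate -/
  Tmax : ℕ
  /-- `T̂`, the maximal number of radius refinements -/
  That : ℕ
  /-- the number of disjoint subsets of private examples -/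
  M : ℕ
  /-- the number of private examples per subset -/
  N : ℕ
  /-- the size of the reduced vocabulary -/
  K : ℕ
  /-- the fraction of the points that the target radius should cover -/
  ρ : ℝ
  /-- the fraction of the points required by the coverage check -/
  μ : ℝ
  /-- the multiplier `λ` of the noise margin -/
  lam : ℝ
  /-- the tolerance of the binary search -/
  θ : ℝ
  /-- noise multiplier of GoodRadius -/
  σ₀ : ℝ
  /-- noise multiplier of the mean estimates -/
  σ₁ : ℝ
  /-- noise multiplier of the coverage checks -/
  σ₂ : ℝ

/-! ### GoodRadius -/

section Points

variable {ι : Type*} [Fintype ι] {M : ℕ}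

/-- The number of points among `x 0, …, x (M - 1)` in the closed ball of radius `r` around `p`. -/
def count (x : Fin M → EuclideanSpace ℝ ι) (p : EuclideanSpace ℝ ι) (r : ℝ) : ℕ :=
  (Finset.univ.filter fun i => ‖x i - p‖ ≤ r).card

/-- `L(r) = (1/t) max_{i₁, …, i_t distinct} ∑ₖ min (count around x_{iₖ}) t`. -/
def scoreL (x : Fin M → EuclideanSpace ℝ ι) (t : ℕ) (r : ℝ) : ℝ :=
  (((Finset.powersetCard t (Finset.univ : Finset (Fin M))).sup
    fun I => ∑ i ∈ I, min (count x (x i) r) t : ℕ) : ℝ) / t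

/-- `⌈log₂ (√2 / (2θ))⌉`, the number of halvings after which an interval of length `√2 / 2` has
length at most `θ`. -/
def searchSteps (θ : ℝ) : ℕ := ⌈Real.logb 2 (√2 / (2 * θ))⌉₊

/-- The while loop of the noisy binary search on `[low, high]`; the first argument bounds the
number of iterations. -/
def searchLoop (L : ℝ → ℝ) (t : ℕ) (σ₀ θ : ℝ) : ℕ → ℝ → ℝ → Measure ℝ
  | 0, low, high => Measure.dirac ((low + high) / 2)
  | k + 1, low, high =>
    if θ < high - low then
      (gaussianReal (L ((low + high) / 2)) (Real.toNNReal (4 * σ₀ ^ 2))).bind fun a =>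
      (gaussianReal (L ((low + high) / 2 / 2)) (Real.toNNReal (4 * σ₀ ^ 2))).bind fun b =>
        if (t : ℝ) ≤ b then searchLoop L t σ₀ θ k low ((low + high) / 2)
        else if (t : ℝ) ≤ a then searchLoop L t σ₀ θ k low ((low + high) / 2)
        else searchLoop L t σ₀ θ k ((low + high) / 2) high
    else Measure.dirac ((low + high) / 2)

/-- The law of the output of GoodRadius on the points `x` with desired ball volume `t`. -/
def goodRadius (x : Fin M → EuclideanSpace ℝ ι) (t : ℕ) (σ₀ θ : ℝ) : Measure ℝ :=
  searchLoop (scoreL x t) t σ₀ θ (searchSteps θ) 0 (√2 / 2)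

/-! ### Precision-focused iterative radius reduction -/

/-- The Gaussian law `N(m, s² I)`. -/
def gaussianVec (m : EuclideanSpace ℝ ι) (s : ℝ) : Measure (EuclideanSpace ℝ ι) :=
  (stdGaussian (EuclideanSpace ℝ ι)).map fun z => m + s • z

/-- The map `p ↦ max (p, 0) / ‖max (p, 0)‖₁` onto the probability simplex (the zero vector if no
coordinate of `p` is positive). -/
def toSimplex (p : EuclideanSpace ℝ ι) : EuclideanSpace ℝ ι :=
  WithLp.toLp 2 fun j => max (p j) 0 / ∑ i, max (p i) 0

/-- Projection of `p` to the ball of radius `R` around `c`. -/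
def clip (c : EuclideanSpace ℝ ι) (R : ℝ) (p : EuclideanSpace ℝ ι) : EuclideanSpace ℝ ι :=
  c + (max 1 (‖p - c‖ / R))⁻¹ • (p - c)

/-- The radius `r + 2 λ R σ₁ √K / M`. -/
def nextRadius (P : Params) (r R : ℝ) : ℝ :=
  r + 2 * P.lam * R * P.σ₁ * √P.K / P.M

/-- The refinement loop with at most the given number of iterations, started at radius `R` and
center `c`: the law of the center with which it ends. -/
def refine (P : Params) (x : Fin P.M → EuclideanSpace ℝ ι) (r : ℝ) :
    ℕ → ℝ → EuclideanSpace ℝ ι → Measure (EuclideanSpace ℝ ι)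
  | 0, _, c => Measure.dirac c
  | j + 1, R, c =>
    (gaussianReal (count x c (nextRadius P r R)) (Real.toNNReal (P.σ₂ ^ 2))).bind fun t =>
      if t < P.μ * P.M then Measure.dirac c
      else if R < nextRadius P r R then Measure.dirac c
      else
        (gaussianVec (∑ i, clip c (nextRadius P r R) (x i))
            (2 * nextRadius P r R * P.σ₁)).bind fun s =>
          refine P x r j (nextRadius P r R) (toSimplex ((P.M : ℝ)⁻¹ • s))

/-- The private aggregation in one token step: the target radius, the mean estimate of the points
themselves at `R = √2 / 2`, and at most `T̂` refinements. -/
def aggregate (P : Params) (x : Fin P.M → EuclideanSpace ℝ ι) : Measure (EuclideanSpace ℝ ι) :=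
  (goodRadius x ⌈P.ρ * P.M⌉₊ P.σ₀ P.θ).bind fun r =>
    (gaussianVec (∑ i, x i) (2 * (√2 / 2) * P.σ₁)).bind fun s =>
      refine P x r P.That (√2 / 2) (toSimplex ((P.M : ℝ)⁻¹ • s))

end Points

/-! ### Next token generation -/

section Tokens

variable {v : ℕ}

/-- The indices of the `K` largest entries of `p`, ties broken in favor of the smaller index. -/
def topK (K : ℕ) (p : Fin v → ℝ) : Finset (Fin v) :=
  Finset.univ.filter fun j =>
    (Finset.univ.filter fun i => p j < p i ∨ (p i = p j ∧ i < j)).card < K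

/-- Restriction of `p` to the coordinates in `S`, rescaled to sum `1`. -/
def rescale (S : Finset (Fin v)) (p : Fin v → ℝ) : EuclideanSpace ℝ S :=
  WithLp.toLp 2 fun j => p j / ∑ i ∈ S, p i

/-- The token in `S` with the largest coordinate of `p`, the smallest one in case of a tie. -/
def argmax [NeZero v] (S : Finset (Fin v)) (p : EuclideanSpace ℝ S) : Fin v :=
  ((Finset.univ.filter fun j : S => ∀ i : S, p i ≤ p j).image Subtype.val).min.untopD 0

variable {X Y Prompt : Type*} [DecidableEq Y]

/-- An ordered draw without replacement of `M` blocks of `N` examples with label `y`. -/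
abbrev Draw {n : ℕ} (M N : ℕ) (D : Fin n → X × Y) (y : Y) : Type :=
  (Fin M × Fin N) ↪ {i : Fin n // (D i).2 = y}

/-- The reduced vocabulary: the top-`K` tokens given the instruction only, without examples. -/
def reducedVocab (LLM : Prompt → stdSimplex ℝ (Fin v))
    (PB : List (X × Y) → Y → List (Fin v) → Prompt) (K : ℕ) (y : Y) (tokens : List (Fin v)) :
    Finset (Fin v) :=
  topK K (LLM (PB [] y tokens) : Fin v → ℝ)

/-- The next-token probability vectors computed from the `M` blocks of drawn examples. -/
def nextTokenProbs (LLM : Prompt → stdSimplex ℝ (Fin v))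
    (PB : List (X × Y) → Y → List (Fin v) → Prompt) {M N : ℕ} {n : ℕ} (D : Fin n → X × Y) (y : Y)
    (S : Finset (Fin v)) (tokens : List (Fin v)) (d : Draw M N D y) (i : Fin M) :
    EuclideanSpace ℝ S :=
  rescale S (LLM (PB (List.ofFn fun k : Fin N => D (d (i, k))) y tokens) : Fin v → ℝ)

/-! ### The algorithm -/

/-- The law of the next token given the tokens generated so far: a uniformly random draw of `M N`
private examples with label `y`, followed by private aggregation and `argmax`. -/
def tokenStep [NeZero v] (LLM : Prompt → stdSimplex ℝ (Fin v))
    (PB : List (X × Y) → Y → List (Fin v) → Prompt) (P : Params) {n : ℕ} (D : Fin n → X × Y)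
    (y : Y) (tokens : List (Fin v)) : Measure (Fin v) :=
  (Fintype.card (Draw P.M P.N D y) : ℝ≥0∞)⁻¹ • ∑ d : Draw P.M P.N D y,
    (aggregate P (nextTokenProbs LLM PB D y (reducedVocab LLM PB P.K y tokens) tokens d)).map
      (argmax (reducedVocab LLM PB P.K y tokens))

/-- Every set of token sequences is an event. -/
instance : MeasurableSpace (List (Fin v)) := ⊤

/-- The law of the token sequence after the given number of further token steps. -/
def generate [NeZero v] (LLM : Prompt → stdSimplex ℝ (Fin v))
    (PB : List (X × Y) → Y → List (Fin v) → Prompt) (P : Params) {n : ℕ} (D : Fin n → X × Y)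
    (y : Y) : ℕ → List (Fin v) → Measure (List (Fin v))
  | 0, tokens => Measure.dirac tokens
  | T + 1, tokens =>
    (tokenStep LLM PB P D y tokens).bind fun w => generate LLM PB P D y T (tokens ++ [w])

/-- The law of the output of AdaDPSyn with label `y` on the private dataset `D`. -/
def adaDPSyn [NeZero v] (LLM : Prompt → stdSimplex ℝ (Fin v))
    (PB : List (X × Y) → Y → List (Fin v) → Prompt) (P : Params) {n : ℕ} (y : Y) {n₀ : ℕ}
    (D : Dataset X Y n y n₀) : Measure (List (Fin v)) :=
  generate LLM PB P D.1 y P.Tmax []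

end Tokens

/-! ### The privacy budget -/

/-- `τ₀(α) = α ⌈log₂ (√2 / (2θ))⌉ / σ₀²`: GoodRadius. -/
def τ₀ (P : Params) (α : ℕ) : ℝ := α * searchSteps P.θ / P.σ₀ ^ 2

/-- `τ₁(α) = α / (2 σ₁²)`: one mean estimate. -/
def τ₁ (P : Params) (α : ℕ) : ℝ := α / (2 * P.σ₁ ^ 2)

/-- `τ₂(α) = α / (2 σ₂²)`: one coverage check. -/
def τ₂ (P : Params) (α : ℕ) : ℝ := α / (2 * P.σ₂ ^ 2)

/-- `τ(α) = τ₀(α) + (T̂ + 1) τ₁(α) + T̂ τ₂(α)`: one token step on the drawn examples. -/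
def stepRDP (P : Params) (α : ℕ) : ℝ :=
  τ₀ P α + (P.That + 1) * τ₁ P α + P.That * τ₂ P α

/-- The order-`α` Rényi bound after subsampling without replacement at rate `γ` of a mechanism
with Rényi bounds `τ j`. The Gaussian mechanisms have `τ(∞) = ∞`, so that each
`min {2, (e^τ(∞) - 1)^j}` in the general bound is `2`. -/
def subsampledRDP (γ : ℝ) (τ : ℕ → ℝ) (α : ℕ) : ℝ :=
  1 / ((α : ℝ) - 1) * Real.log (1
    + γ ^ 2 * (α.choose 2) * min (4 * (Real.exp (τ 2) - 1)) (Real.exp (τ 2) * 2)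
    + ∑ j ∈ Finset.Icc 3 α, γ ^ j * (α.choose j) * Real.exp (((j : ℝ) - 1) * τ j) * 2)

/-- `ε = T_max τ'(α) + log ((α - 1) / α) - (log δ + log α) / (α - 1)`, where `τ'` is the bound for
one token step amplified by drawing `M N` out of `n₀` examples. -/
def epsilon (P : Params) (n₀ α : ℕ) (δ : ℝ) : ℝ :=
  P.Tmax * subsampledRDP ((P.M * P.N : ℕ) / n₀) (stepRDP P) α
    + Real.log (((α : ℝ) - 1) / α) - (Real.log δ + Real.log α) / ((α : ℝ) - 1)

end AdaDPSyn

end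

/-! The proof is Rényi accounting. A Rényi bound of order `a` is stated dually (`RenyiLE`): with `q`
the exponent conjugate to `a`, the `q`-th power of `∫ f dμ` is at most `e^τ ∫ f^q dν` for all `f ≥
0`. In this form no density is needed: post-processing is substitution (`RenyiLE.map`), adaptive
composition is iterated integration (`RenyiLE.bind`), and mixtures with equal weights are handled by
Jensen. Testing with an indicator and applying Young's inequality gives the `(ε, δ)` statement
(`RenyiLE.measure_le`).

For fixed drawn examples, a token step is an adaptive sequence of Gaussian releases. If one example
changes, only one point `p^i` changes, so `L` moves by at most 2, a coverage count by at most 1, and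
a sum of vectors by at most twice the current radius. Each noise level is proportional to its
sensitivity, so the costs depend only on the multipliers and add up to `stepRDP`
(`renyiLE_aggregate`).

Sampling amplifies this bound. Remove the differing entry from both datasets; the remaining records
with the given label form a common population `β`, and each dataset adds at most one element to it.
A draw contains the extra element with probability `g ≤ γ`, and then looks like a draw from `β` with
one uniformly chosen slot overwritten (`average_embedding_option`). Thus the two token laws differ
by `g` times a mixture of differences of laws whose inputs differ in one slot. Expanding the `α`-th
moment of the likelihood ratio around 1 removes the linear term, and the term of degree `j` is
bounded by joint convexity with a factor `γ^j` (`RenyiLE.subsample`). This is carried out for the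
law of the token, where the space is finite and moments are finite sums. Composition over the
`T_max` tokens finishes the argument. -/

noncomputable section

namespace AdaDPSyn

/-! ### Rényi divergence bounds in dual form -/

section Renyi

variable {Ω Ω' : Type*} [MeasurableSpace Ω] [MeasurableSpace Ω']

/-- The Rényi divergence of order `a` of `μ` from `ν` is at most `τ`, in the dual form given by
Hölder's inequality with the exponent conjugate to `a`. -/
def RenyiLE (a τ : ℝ) (μ ν : Measure Ω) : Prop :=
  ∀ f : Ω → ℝ≥0∞, Measurable f →
    (∫⁻ x, f x ∂μ) ^ a.conjExponent ≤
      ENNReal.ofReal (Real.exp τ) * ∫⁻ x, f x ^ a.conjExponent ∂ν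

variable {a τ τ' : ℝ} {μ ν : Measure Ω}

/-- Hölder's inequality for `f * h`, raised to the conjugate power; the moment of `h` then carries
the exponent `1 / (a - 1)`. -/
lemma RenyiLE.of_density (ha : 1 < a) {h : Ω → ℝ≥0∞} (hh : Measurable h)
    (hμ : μ = ν.withDensity h)
    (hτ : ∫⁻ x, h x ^ a ∂ν ≤ ENNReal.ofReal (Real.exp ((a - 1) * τ))) : RenyiLE a τ μ ν := by
  intro f hf
  have hc : a.conjExponent.HolderConjugate a := (Real.HolderConjugate.conjExponent ha).symm
  have hq : 0 < a.conjExponent := hc.pos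
  have h1 : ∫⁻ x, f x ∂μ ≤ (∫⁻ x, f x ^ a.conjExponent ∂ν) ^ (1 / a.conjExponent) *
      (∫⁻ x, h x ^ a ∂ν) ^ (1 / a) := by
    rw [hμ, lintegral_withDensity_eq_lintegral_mul _ hh hf, mul_comm]
    exact ENNReal.lintegral_mul_le_Lp_mul_Lq ν hc hf.aemeasurable hh.aemeasurable
  refine (ENNReal.rpow_le_rpow h1 hq.le).trans ?_
  rw [ENNReal.mul_rpow_of_nonneg _ _ hq.le, ← ENNReal.rpow_mul, ← ENNReal.rpow_mul,
    one_div_mul_cancel hq.ne', ENNReal.rpow_one, mul_comm]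
  gcongr
  have hqa : 1 / a * a.conjExponent = 1 / (a - 1) := by
    rw [Real.conjExponent]; field_simp
  rw [hqa]
  refine (ENNReal.rpow_le_rpow hτ (by simp; linarith)).trans ?_
  rw [ENNReal.ofReal_rpow_of_pos (Real.exp_pos _), ← Real.exp_mul]
  have : a - 1 ≠ 0 := by linarith
  rw [show (a - 1) * τ * (1 / (a - 1)) = τ by field_simp]

lemma RenyiLE.mono (h : RenyiLE a τ μ ν) (hτ : τ ≤ τ') : RenyiLE a τ' μ ν := fun f hf =>
  (h f hf).trans (by gcongr)

lemma RenyiLE.refl (ha : 1 < a) (hτ : 0 ≤ τ) (μ : Measure Ω) [IsProbabilityMeasure μ] :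
    RenyiLE a τ μ μ :=
  RenyiLE.of_density ha (h := fun _ => 1) measurable_const (by simp) (by
    simp only [ENNReal.one_rpow, lintegral_const, measure_univ, mul_one]
    rw [ENNReal.one_le_ofReal, Real.one_le_exp_iff]
    have : 0 ≤ a - 1 := by linarith
    positivity)

/-- Adaptive composition: the outer bound is tested on the inner integral `x ↦ ∫ f dκ x`, whose
`q`-th power the inner bound controls. Only `ν`-almost every `x` matters, which later allows
discarding nonpositive radii. -/
lemma RenyiLE.bind (h : RenyiLE a τ μ ν) {κ η : Ω → Measure Ω'} (hκ : Measurable κ)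
    (hη : Measurable η) (hκη : ∀ᵐ x ∂ν, RenyiLE a τ' (κ x) (η x)) :
    RenyiLE a (τ + τ') (μ.bind κ) (ν.bind η) := by
  intro f hf
  rw [Measure.lintegral_bind hκ.aemeasurable hf.aemeasurable,
    Measure.lintegral_bind hη.aemeasurable (hf.pow_const _).aemeasurable]
  refine (h _ ((Measure.measurable_lintegral hf).comp hκ)).trans ?_
  rw [Real.exp_add, ENNReal.ofReal_mul (Real.exp_pos _).le, mul_assoc]
  gcongr
  have hm : Measurable fun x => ∫⁻ y, f y ^ a.conjExponent ∂η x :=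
    (Measure.measurable_lintegral (hf.pow_const _)).comp hη
  rw [← lintegral_const_mul _ hm]
  exact lintegral_mono_ae (hκη.mono fun x hx => hx f hf)

lemma RenyiLE.map (h : RenyiLE a τ μ ν) {g : Ω → Ω'} (hg : Measurable g) :
    RenyiLE a τ (μ.map g) (ν.map g) := by
  intro f hf
  rw [lintegral_map hf hg, lintegral_map (hf.pow_const _) hg]
  exact h _ (hf.comp hg)

lemma RenyiLE.prod {μ' ν' : Measure Ω'} [IsProbabilityMeasure μ]
    [IsProbabilityMeasure ν] [IsProbabilityMeasure μ'] [IsProbabilityMeasure ν']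
    (h : RenyiLE a τ μ ν) (h' : RenyiLE a τ' μ' ν') :
    RenyiLE a (τ + τ') (μ.prod μ') (ν.prod ν') := by
  have key : ∀ ρ : Measure Ω', IsProbabilityMeasure ρ →
      Measurable fun x : Ω => ρ.map (Prod.mk x) := fun ρ _ => Measurable.map_prodMk_left
  rw [Measure.prod_def, Measure.prod_def]
  exact h.bind (key μ' inferInstance) (key ν' inferInstance)
    (Filter.Eventually.of_forall fun x => h'.map measurable_prodMk_left)

lemma RenyiLE.pi (ha : 1 < a) {n : ℕ} {t : Fin n → ℝ} {m m' : Fin n → Measure Ω}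
    [∀ i, IsProbabilityMeasure (m i)] [∀ i, IsProbabilityMeasure (m' i)]
    (h : ∀ i, RenyiLE a (t i) (m i) (m' i)) :
    RenyiLE a (∑ i, t i) (Measure.pi m) (Measure.pi m') := by
  induction n with
  | zero =>
    have : Measure.pi m = Measure.pi m' := by congr 1; ext1 i; exact i.elim0
    rw [this]
    exact RenyiLE.refl ha (by simp) _
  | succ n ih =>
    have e := fun m : Fin (n + 1) → Measure Ω => fun [∀ i, IsProbabilityMeasure (m i)] =>
      ((measurePreserving_piFinSuccAbove m 0).symm).map_eq
    rw [← e m, ← e m', Fin.sum_univ_succ]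
    exact ((h 0).prod (ih fun i => h _)).map (MeasurableEquiv.measurable _)

/-- Joint convexity: mixtures with the same weights. -/
lemma RenyiLE.sum_smul (ha : 1 < a) {κ : Type*} [Fintype κ] {w : κ → ℝ≥0∞} (hw : ∑ k, w k = 1)
    {m m' : κ → Measure Ω} (h : ∀ k, RenyiLE a τ (m k) (m' k)) :
    RenyiLE a τ (∑ k, w k • m k) (∑ k, w k • m' k) := by
  intro f hf
  have hq : 1 ≤ a.conjExponent := (Real.HolderConjugate.conjExponent ha).symm.lt.le
  simp only [lintegral_finsetSum_measure, lintegral_smul_measure, smul_eq_mul]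
  refine (ENNReal.rpow_arith_mean_le_arith_mean_rpow _ w _ hw hq).trans ?_
  rw [Finset.mul_sum]
  refine Finset.sum_le_sum fun k _ => ?_
  rw [mul_left_comm]
  gcongr
  exact h k f hf

/-- The likelihood ratio is the exponential of an affine function, so its `a`-th moment is a value
of the Gaussian moment generating function. -/
lemma RenyiLE.gaussianReal (ha : 1 < a) (m m' : ℝ) {v : NNReal} (hv : v ≠ 0)
    (hτ : a * (m - m') ^ 2 / (2 * v) ≤ τ) :
    RenyiLE a τ (gaussianReal m v) (gaussianReal m' v) := by
  have hv' : (0 : ℝ) < v := by positivity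
  refine RenyiLE.mono ?_ hτ
  refine RenyiLE.of_density ha
    (h := fun x => ENNReal.ofReal (Real.exp ((m - m') / v * x - (m ^ 2 - m' ^ 2) / (2 * v))))
    (by fun_prop) ?_ ?_
  · rw [gaussianReal_of_var_ne_zero _ hv, gaussianReal_of_var_ne_zero _ hv,
      ← withDensity_mul _ (by fun_prop) (by fun_prop)]
    congr 1
    ext x
    simp only [Pi.mul_apply, gaussianPDF, gaussianPDFReal]
    rw [← ENNReal.ofReal_mul (by positivity), mul_assoc (√(2 * Real.pi * v))⁻¹, ← Real.exp_add]
    congr 3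
    field_simp
    ring
  · have e : ∀ x, ENNReal.ofReal (Real.exp ((m - m') / v * x - (m ^ 2 - m' ^ 2) / (2 * v))) ^ a
        = ENNReal.ofReal (Real.exp (-(a * ((m ^ 2 - m' ^ 2) / (2 * v)))) *
          Real.exp (a * ((m - m') / v) * x)) := by
      intro x
      rw [ENNReal.ofReal_rpow_of_pos (Real.exp_pos _), ← Real.exp_mul, ← Real.exp_add]
      congr 2
      ring
    simp_rw [e]
    rw [← ofReal_integral_eq_lintegral_ofReal
      ((integrable_exp_mul_gaussianReal _).const_mul _)
      (Filter.Eventually.of_forall fun x => by positivity), integral_const_mul]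
    refine ENNReal.ofReal_le_ofReal (le_of_eq ?_)
    have := congrFun (mgf_fun_id_gaussianReal (μ := m') (v := v)) (a * ((m - m') / v))
    rw [mgf] at this
    rw [this, ← Real.exp_add]
    congr 1
    field_simp
    ring

/-- An indicator gives `μ(S)^q ≤ e^τ ν(S)`. Young's inequality linearizes the power at the price of
an additive constant, which is tuned to be `δ`. -/
lemma RenyiLE.measure_le {α : ℕ} (hα : 2 ≤ α) {δ ε : ℝ} (hδ : 0 < δ) (h : RenyiLE α τ μ ν)
    (hε : τ + Real.log (((α : ℝ) - 1) / α) - (Real.log δ + Real.log α) / ((α : ℝ) - 1) ≤ ε)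
    [IsProbabilityMeasure μ] [IsProbabilityMeasure ν] {S : Set Ω} (hS : MeasurableSet S) :
    μ S ≤ ENNReal.ofReal (Real.exp ε) * ν S + ENNReal.ofReal δ := by
  have hα' : (2 : ℝ) ≤ α := by exact_mod_cast hα
  have ha : (1 : ℝ) < α := by linarith
  have hc := Real.HolderConjugate.conjExponent ha
  set q := (α : ℝ).conjExponent with hq
  have hq0 : 0 < q := hc.symm.pos
  have h1 := h (S.indicator 1) (measurable_one.indicator hS)
  have h2 : ∀ x, S.indicator (1 : Ω → ℝ≥0∞) x ^ q = S.indicator 1 x := by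
    intro x
    by_cases hx : x ∈ S <;> simp [hx, hq0]
  simp_rw [← hq, h2, lintegral_indicator_one hS] at h1
  obtain ⟨x, hx⟩ : ∃ x, x = (μ S).toReal := ⟨_, rfl⟩
  obtain ⟨z, hz⟩ : ∃ z, z = (ν S).toReal := ⟨_, rfl⟩
  have hx0 : 0 ≤ x := hx ▸ ENNReal.toReal_nonneg
  have hz0 : 0 ≤ z := hz ▸ ENNReal.toReal_nonneg
  rw [← ENNReal.ofReal_toReal (measure_ne_top μ S), ← ENNReal.ofReal_toReal (measure_ne_top ν S),
    ← hx, ← hz] at h1 ⊢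
  rw [ENNReal.ofReal_rpow_of_nonneg hx0 hq0.le, ← ENNReal.ofReal_mul (Real.exp_pos _).le,
    ENNReal.ofReal_le_ofReal_iff (by positivity)] at h1
  rw [← ENNReal.ofReal_mul (Real.exp_pos _).le, ← ENNReal.ofReal_add (by positivity) hδ.le]
  refine ENNReal.ofReal_le_ofReal ?_
  have hαδ : 0 < α * δ := by positivity
  have hα1 : (0 : ℝ) < α - 1 := by linarith
  -- Young is applied to `x = c * (x / c)`; this `c` makes the first term `c ^ α / α` equal to `δ`.
  set c : ℝ := (α * δ) ^ (1 / (α : ℝ)) with hcdef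
  have hc0 : 0 < c := Real.rpow_pos_of_pos hαδ _
  have hy := Real.young_inequality_of_nonneg hc0.le (div_nonneg hx0 hc0.le) hc
  rw [mul_div_cancel₀ _ hc0.ne'] at hy
  refine hy.trans ?_
  have e1 : c ^ (α : ℝ) / α = δ := by
    rw [hcdef, ← Real.rpow_mul hαδ.le, one_div_mul_cancel (by positivity), Real.rpow_one]
    field_simp
  rw [e1, add_comm]
  gcongr
  rw [Real.div_rpow hx0 hc0.le]
  have hcq : c ^ q = Real.exp ((Real.log δ + Real.log α) / (α - 1)) := by
    rw [hcdef, ← Real.rpow_mul hαδ.le, Real.rpow_def_of_pos hαδ,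
      Real.log_mul (by positivity) hδ.ne', hq, Real.conjExponent]
    congr 1
    field_simp
    ring
  have hqinv : 1 / q = Real.exp (Real.log (((α : ℝ) - 1) / α)) := by
    rw [Real.exp_log (by positivity), hq, Real.conjExponent, one_div_div]
  calc x ^ q / c ^ q / q = x ^ q * (1 / q) / c ^ q := by ring
    _ ≤ Real.exp τ * z * (1 / q) / c ^ q := by gcongr
    _ = Real.exp (τ + Real.log (((α : ℝ) - 1) / α)
          - (Real.log δ + Real.log α) / ((α : ℝ) - 1)) * z := by
      rw [hcq, hqinv, Real.exp_sub, Real.exp_add]; ring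
    _ ≤ _ := by gcongr

end Renyi

/-! ### Gaussian vectors -/

section Gauss

variable {ι : Type*} [Fintype ι]

/-- In an orthonormal basis the coordinates are independent, so the vector bound reduces to the
one-dimensional one by `RenyiLE.pi`, the squared coordinates of `m - m'` summing to its squared
norm. -/
lemma gaussianVec_eq_map_pi (m : EuclideanSpace ℝ ι) (s : ℝ) :
    gaussianVec m s = (Measure.pi fun i => gaussianReal
      (inner ℝ (stdOrthonormalBasis ℝ (EuclideanSpace ℝ ι) i) m) (Real.toNNReal (s ^ 2))).map
        fun y => ∑ i, y i • stdOrthonormalBasis ℝ (EuclideanSpace ℝ ι) i := by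
  have h1 : ∀ c : ℝ, gaussianReal c (Real.toNNReal (s ^ 2)) =
      (gaussianReal 0 1).map fun z => c + s * z := by
    intro c
    have := gaussianReal_map_const_mul (μ := 0) (v := 1) s
    rw [show (fun z => c + s * z) = (fun z => c + z) ∘ (fun z => s * z) from rfl,
      ← Measure.map_map (by fun_prop) (by fun_prop), this, gaussianReal_map_const_add]
    congr 1
    · simp
    · rw [mul_one]
      ext; simp [sq_nonneg]
  simp_rw [h1]
  rw [← Measure.pi_map_pi (fun i => by fun_prop), Measure.map_map (by fun_prop) (by fun_prop),
    gaussianVec, stdGaussian, Measure.map_map (by fun_prop) (by fun_prop)]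
  congr 1
  ext1 z
  simp only [Function.comp_apply, add_smul, Finset.sum_add_distrib, mul_smul, ← Finset.smul_sum]
  rw [OrthonormalBasis.sum_repr']

instance isProbabilityMeasure_gaussianVec (m : EuclideanSpace ℝ ι) (s : ℝ) :
    IsProbabilityMeasure (gaussianVec m s) :=
  Measure.isProbabilityMeasure_map (by fun_prop)

lemma RenyiLE.gaussianVec {a τ : ℝ} (ha : 1 < a) (m m' : EuclideanSpace ℝ ι) {s : ℝ} (hs : 0 < s)
    (hτ : a * ‖m - m'‖ ^ 2 / (2 * s ^ 2) ≤ τ) :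
    RenyiLE a τ (gaussianVec m s) (gaussianVec m' s) := by
  refine RenyiLE.mono ?_ hτ
  rw [gaussianVec_eq_map_pi, gaussianVec_eq_map_pi]
  refine RenyiLE.map ?_ (by fun_prop)
  have := (stdOrthonormalBasis ℝ (EuclideanSpace ℝ ι)).sum_sq_inner_right (m - m')
  rw [← this, Finset.mul_sum, Finset.sum_div]
  refine RenyiLE.pi ha fun i => RenyiLE.gaussianReal ha _ _ (by simp [hs.ne']) ?_
  rw [inner_sub_right, Real.coe_toNNReal _ (sq_nonneg s)]

end Gauss

/-! ### Measurability of the randomized loops -/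

section Meas

variable {α β γ : Type*} [MeasurableSpace α] [MeasurableSpace β] [MeasurableSpace γ]

/-- In the loops a continuation depends on earlier outcomes as well as on the fresh sample, hence
the joint measurability. -/
lemma measurable_bind_uncurry {μ : α → Measure β} {κ : α → β → Measure γ} (hμ : Measurable μ)
    [∀ x, IsProbabilityMeasure (μ x)] (hκ : Measurable (Function.uncurry κ)) :
    Measurable fun x => (μ x).bind (κ x) := by
  refine Measure.measurable_of_measurable_coe _ fun s hs => ?_
  have e : ∀ x, (μ x).bind (κ x) s = ∫⁻ y, κ x y s ∂(μ x) := fun x =>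
    Measure.bind_apply hs (hκ.comp measurable_prodMk_left).aemeasurable
  simp_rw [e]
  let K : Kernel α β := ⟨μ, hμ⟩
  have : IsMarkovKernel K := ⟨fun x => by change IsProbabilityMeasure (μ x); infer_instance⟩
  exact Measurable.lintegral_kernel_prod_right (κ := K) ((Measure.measurable_coe hs).comp hκ)

lemma isProbabilityMeasure_bind' {μ : Measure α} [IsProbabilityMeasure μ] {κ : α → Measure β}
    (hκ : Measurable κ) (h : ∀ x, IsProbabilityMeasure (κ x)) :
    IsProbabilityMeasure (μ.bind κ) :=
  ⟨by rw [Measure.bind_apply MeasurableSet.univ hκ.aemeasurable]; simp⟩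

lemma ae_bind {μ : Measure α} {κ : α → Measure β} (hκ : Measurable κ) {p : β → Prop}
    (hp : MeasurableSet {x | p x}) (h : ∀ x, ∀ᵐ y ∂(κ x), p y) : ∀ᵐ y ∂(μ.bind κ), p y := by
  rw [ae_iff, Measure.bind_apply (by simpa [Set.compl_def] using hp.compl) hκ.aemeasurable]
  simp only [ae_iff] at h
  simp [h]

end Meas

/-! ### GoodRadius -/

section SearchLoop

variable (L : ℝ → ℝ) (t : ℕ) (σ₀ θ : ℝ)

lemma measurable_search_branch (A B : Measure ℝ) :
    Measurable (Function.uncurry fun a b : ℝ =>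
      if (t : ℝ) ≤ b then A else if (t : ℝ) ≤ a then A else B) :=
  Measurable.ite (measurableSet_le measurable_const measurable_snd) measurable_const
    (Measurable.ite (measurableSet_le measurable_const measurable_fst) measurable_const
      measurable_const)

lemma measurable_search_branch_bind (A B : Measure ℝ) (m : ℝ) (v : NNReal) :
    Measurable fun a : ℝ => (gaussianReal m v).bind fun b =>
      if (t : ℝ) ≤ b then A else if (t : ℝ) ≤ a then A else B :=
  measurable_bind_uncurry measurable_const (measurable_search_branch t A B)

lemma isProbabilityMeasure_searchLoop (k : ℕ) (low high : ℝ) :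
    IsProbabilityMeasure (searchLoop L t σ₀ θ k low high) := by
  induction k generalizing low high with
  | zero => rw [searchLoop]; infer_instance
  | succ k ih =>
    rw [searchLoop]
    split_ifs
    · refine isProbabilityMeasure_bind' (measurable_search_branch_bind t _ _ _ _) fun a => ?_
      refine isProbabilityMeasure_bind'
        ((measurable_search_branch t _ _).comp measurable_prodMk_left) fun b => ?_
      split_ifs <;> exact ih _ _
    · infer_instance

/-- The interval never degenerates, so its midpoint stays positive. A positive target radius makes
every later clipping radius and noise scale positive. -/
lemma ae_searchLoop_pos (k : ℕ) {low high : ℝ} (hl : 0 ≤ low) (hh : low < high) :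
    ∀ᵐ r ∂(searchLoop L t σ₀ θ k low high), 0 < r := by
  have hd : ∀ᵐ r ∂(Measure.dirac ((low + high) / 2)), 0 < r := by
    rw [ae_dirac_iff measurableSet_Ioi]
    linarith
  induction k generalizing low high with
  | zero => rwa [searchLoop]
  | succ k ih =>
    have hA : ∀ᵐ r ∂(searchLoop L t σ₀ θ k low ((low + high) / 2)), 0 < r := by
      refine ih hl (by linarith) ?_
      rw [ae_dirac_iff measurableSet_Ioi]
      linarith
    have hB : ∀ᵐ r ∂(searchLoop L t σ₀ θ k ((low + high) / 2) high), 0 < r := by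
      refine ih (by linarith) (by linarith) ?_
      rw [ae_dirac_iff measurableSet_Ioi]
      linarith
    rw [searchLoop]
    split_ifs
    · refine ae_bind (measurable_search_branch_bind t _ _ _ _) measurableSet_Ioi fun a => ?_
      refine ae_bind
        ((measurable_search_branch t _ _).comp measurable_prodMk_left) measurableSet_Ioi fun b => ?_
      simp only [Function.comp_apply, Function.uncurry_apply_pair]
      split_ifs <;> assumption
    · exact hd

variable {L} in
-- Sensitivity 2 against variance `4 σ₀²` costs `a / (2 σ₀²)` per query, and each halving makes two
-- queries. Once the answers are fixed, both runs take the same branch.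
lemma renyiLE_searchLoop {a : ℝ} (ha : 1 < a) {L' : ℝ → ℝ} (hσ : 0 < σ₀)
    (hL : ∀ s, |L s - L' s| ≤ 2) (k : ℕ) (low high : ℝ) :
    RenyiLE a (a * k / σ₀ ^ 2) (searchLoop L t σ₀ θ k low high)
      (searchLoop L' t σ₀ θ k low high) := by
  have hg : ∀ s, RenyiLE a (a / (2 * σ₀ ^ 2)) (gaussianReal (L s) (Real.toNNReal (4 * σ₀ ^ 2)))
      (gaussianReal (L' s) (Real.toNNReal (4 * σ₀ ^ 2))) := by
    intro s
    refine RenyiLE.gaussianReal ha _ _ ?_ ?_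
    · exact (Real.toNNReal_pos.2 (by positivity)).ne'
    · rw [Real.coe_toNNReal _ (by positivity)]
      have h4 : (L s - L' s) ^ 2 ≤ 4 := by
        have := sq_le_sq' (abs_le.1 (hL s)).1 (abs_le.1 (hL s)).2
        linarith
      calc a * (L s - L' s) ^ 2 / (2 * (4 * σ₀ ^ 2)) ≤ a * 4 / (2 * (4 * σ₀ ^ 2)) := by gcongr
        _ = a / (2 * σ₀ ^ 2) := by field_simp
  induction k generalizing low high with
  | zero =>
    rw [searchLoop, searchLoop]
    exact RenyiLE.refl ha (by simp) _
  | succ k ih =>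
    rw [searchLoop, searchLoop]
    split_ifs
    · refine RenyiLE.mono (τ := a / (2 * σ₀ ^ 2) + (a / (2 * σ₀ ^ 2) + a * k / σ₀ ^ 2)) ?_ ?_
      · refine (hg _).bind (measurable_search_branch_bind t _ _ _ _)
          (measurable_search_branch_bind t _ _ _ _) (Filter.Eventually.of_forall fun x => ?_)
        refine (hg _).bind ((measurable_search_branch t _ _).comp measurable_prodMk_left)
          ((measurable_search_branch t _ _).comp measurable_prodMk_left)
          (Filter.Eventually.of_forall fun y => ?_)
        change RenyiLE a _ (if _ then _ else _) (if _ then _ else _)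
        split_ifs <;> exact ih _ _
      · push_cast
        apply le_of_eq
        field_simp
        ring
    · exact RenyiLE.refl ha (by positivity) _

end SearchLoop

/-! ### Sensitivity of counts and scores -/

section Points

variable {ι : Type*} [Fintype ι] {M : ℕ}

lemma count_le_count_add_one {x x' : Fin M → EuclideanSpace ℝ ι} {i₀ : Fin M}
    (hx : ∀ i, i ≠ i₀ → x i = x' i) (p : EuclideanSpace ℝ ι) (r : ℝ) :
    count x p r ≤ count x' p r + 1 := by
  classical
  unfold count
  refine (Finset.card_le_card ?_).trans (Finset.card_insert_le i₀ _)
  intro i hi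
  by_cases h : i = i₀
  · simp [h]
  · simpa [h, hx i h] using hi

lemma abs_count_sub_le {x x' : Fin M → EuclideanSpace ℝ ι} {i₀ : Fin M}
    (hx : ∀ i, i ≠ i₀ → x i = x' i) (p : EuclideanSpace ℝ ι) (r : ℝ) :
    |(count x p r : ℝ) - count x' p r| ≤ 1 := by
  have h1 : (count x p r : ℝ) ≤ count x' p r + 1 := by
    exact_mod_cast count_le_count_add_one hx p r
  have h2 : (count x' p r : ℝ) ≤ count x p r + 1 := by
    exact_mod_cast count_le_count_add_one (fun i hi => (hx i hi).symm) p r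
  rw [abs_le]
  constructor <;> linarith

/-- The summand of the moved point is capped at `t`, so it contributes a change of at most `t`;
every other summand keeps its center and gains at most 1. With `t` summands this is at most `2 * t`,
hence sensitivity 2 after division by `t`. -/
lemma sup_sum_count_le {x x' : Fin M → EuclideanSpace ℝ ι} {i₀ : Fin M}
    (hx : ∀ i, i ≠ i₀ → x i = x' i) (t : ℕ) (r : ℝ) :
    ((Finset.powersetCard t (Finset.univ : Finset (Fin M))).sup
      fun I => ∑ i ∈ I, min (count x (x i) r) t) ≤
    ((Finset.powersetCard t (Finset.univ : Finset (Fin M))).sup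
      fun I => ∑ i ∈ I, min (count x' (x' i) r) t) + 2 * t := by
  refine Finset.sup_le fun I hI => ?_
  have hc := (Finset.mem_powersetCard.1 hI).2
  have h1 : ∑ i ∈ I, min (count x (x i) r) t ≤
      ∑ i ∈ I, (min (count x' (x' i) r) t + ((if i = i₀ then t else 0) + 1)) := by
    refine Finset.sum_le_sum fun i _ => ?_
    split_ifs with h
    · omega
    · have := count_le_count_add_one hx (x i) r
      rw [← hx i h]
      omega
  refine h1.trans ?_
  rw [Finset.sum_add_distrib, Finset.sum_add_distrib, Finset.sum_const, hc, Finset.sum_ite_eq']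
  have h2 := Finset.le_sup (f := fun I => ∑ i ∈ I, min (count x' (x' i) r) t) hI
  simp only [smul_eq_mul, mul_one]
  split_ifs <;> omega

lemma scoreL_le {x x' : Fin M → EuclideanSpace ℝ ι} {i₀ : Fin M}
    (hx : ∀ i, i ≠ i₀ → x i = x' i) (t : ℕ) (r : ℝ) : scoreL x t r ≤ scoreL x' t r + 2 := by
  unfold scoreL
  rcases Nat.eq_zero_or_pos t with rfl | ht
  · simp
  · have ht' : (0 : ℝ) < t := by exact_mod_cast ht
    rw [div_add' _ _ _ ht'.ne']
    gcongr
    exact_mod_cast sup_sum_count_le hx t r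

lemma abs_scoreL_sub_le {x x' : Fin M → EuclideanSpace ℝ ι} {i₀ : Fin M}
    (hx : ∀ i, i ≠ i₀ → x i = x' i) (t : ℕ) (r : ℝ) : |scoreL x t r - scoreL x' t r| ≤ 2 := by
  have h1 := scoreL_le hx t r
  have h2 := scoreL_le (fun i hi => (hx i hi).symm) t r
  rw [abs_le]
  constructor <;> linarith

/-! ### Radius refinement -/

lemma norm_clip_sub_le (c : EuclideanSpace ℝ ι) {R : ℝ} (hR : 0 < R) (p : EuclideanSpace ℝ ι) :
    ‖clip c R p - c‖ ≤ R := by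
  have h0 : 0 < max 1 (‖p - c‖ / R) := lt_max_of_lt_left one_pos
  rw [clip, add_sub_cancel_left, norm_smul, norm_inv, Real.norm_of_nonneg h0.le,
    inv_mul_le_iff₀ h0]
  calc ‖p - c‖ = ‖p - c‖ / R * R := by field_simp
    _ ≤ _ := by gcongr; exact le_max_right _ _

lemma norm_sum_sub_sum {E : Type*} [SeminormedAddCommGroup E] {f g : Fin M → E} {i₀ : Fin M}
    (h : ∀ i, i ≠ i₀ → f i = g i) : ‖∑ i, f i - ∑ i, g i‖ = ‖f i₀ - g i₀‖ := by
  rw [← Finset.sum_sub_distrib, Finset.sum_eq_single i₀ (fun i _ hi => by simp [h i hi])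
    (by simp)]

lemma measurable_gaussianVec :
    Measurable fun q : EuclideanSpace ℝ ι × ℝ => gaussianVec q.1 q.2 := by
  have e : ∀ q : EuclideanSpace ℝ ι × ℝ, gaussianVec q.1 q.2 =
      (stdGaussian (EuclideanSpace ℝ ι)).bind fun z => Measure.dirac (q.1 + q.2 • z) := by
    intro q
    rw [gaussianVec, ← Measure.bind_dirac_eq_map _ (by fun_prop)]
  simp_rw [e]
  refine measurable_bind_uncurry measurable_const (Measure.measurable_dirac.comp ?_)
  fun_prop

lemma measurable_toSimplex : Measurable (toSimplex : EuclideanSpace ℝ ι → EuclideanSpace ℝ ι) := by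
  unfold toSimplex
  refine (PiLp.continuous_toLp 2 _).measurable.comp (measurable_pi_lambda _ fun j => ?_)
  refine Measurable.div ?_ (Finset.measurable_sum _ fun i _ => ?_) <;> fun_prop

lemma measurable_clip (p : EuclideanSpace ℝ ι) :
    Measurable fun q : EuclideanSpace ℝ ι × ℝ => clip q.1 q.2 p := by
  unfold clip
  fun_prop

lemma measurable_count (x : Fin M → EuclideanSpace ℝ ι) :
    Measurable fun q : EuclideanSpace ℝ ι × ℝ => (count x q.1 q.2 : ℝ) := by
  simp only [count, Finset.card_filter, Nat.cast_sum]
  refine Finset.measurable_sum _ fun i _ => ?_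
  simp only [Nat.cast_ite]
  exact Measurable.ite (measurableSet_le (by fun_prop) (by fun_prop)) measurable_const
    measurable_const

variable (P : Params) (x : Fin P.M → EuclideanSpace ℝ ι)

/-- The law of the rest of `refine` after the coverage check. -/
def refineBranch (r : ℝ) (j : ℕ) (R : ℝ) (c : EuclideanSpace ℝ ι) (t : ℝ) :
    Measure (EuclideanSpace ℝ ι) :=
  if t < P.μ * P.M then Measure.dirac c
  else if R < nextRadius P r R then Measure.dirac c
  else
    (gaussianVec (∑ i, clip c (nextRadius P r R) (x i)) (2 * nextRadius P r R * P.σ₁)).bind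
      fun s => refine P x r j (nextRadius P r R) (toSimplex ((P.M : ℝ)⁻¹ • s))

lemma refine_succ (r : ℝ) (j : ℕ) (R : ℝ) (c : EuclideanSpace ℝ ι) :
    refine P x r (j + 1) R c =
      (gaussianReal (count x c (nextRadius P r R)) (Real.toNNReal (P.σ₂ ^ 2))).bind
        (refineBranch P x r j R c) := rfl

lemma measurable_nextRadius : Measurable fun q : ℝ × ℝ => nextRadius P q.1 q.2 := by
  unfold nextRadius
  fun_prop

variable {P x} in
lemma measurable_refineBranch {j : ℕ}
    (h : Measurable fun q : ℝ × ℝ × EuclideanSpace ℝ ι => refine P x q.1 j q.2.1 q.2.2) :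
    Measurable fun q : (ℝ × ℝ × EuclideanSpace ℝ ι) × ℝ =>
      refineBranch P x q.1.1 j q.1.2.1 q.1.2.2 q.2 := by
  have hR : Measurable fun q : (ℝ × ℝ × EuclideanSpace ℝ ι) × ℝ =>
      nextRadius P q.1.1 q.1.2.1 :=
    (measurable_nextRadius P).comp (by fun_prop : Measurable fun q :
      (ℝ × ℝ × EuclideanSpace ℝ ι) × ℝ => (q.1.1, q.1.2.1))
  have hd : Measurable fun q : (ℝ × ℝ × EuclideanSpace ℝ ι) × ℝ => Measure.dirac q.1.2.2 :=
    Measure.measurable_dirac.comp (by fun_prop)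
  have hc : Measurable fun q : (ℝ × ℝ × EuclideanSpace ℝ ι) × ℝ => q.1.2.2 := by fun_prop
  have hs : Measurable fun q : (ℝ × ℝ × EuclideanSpace ℝ ι) × ℝ =>
      ∑ i, clip q.1.2.2 (nextRadius P q.1.1 q.1.2.1) (x i) :=
    Finset.measurable_sum _ fun i _ => (measurable_clip (x i)).comp (hc.prodMk hR)
  have hS : Measurable fun q : ((ℝ × ℝ × EuclideanSpace ℝ ι) × ℝ) × EuclideanSpace ℝ ι =>
      toSimplex ((P.M : ℝ)⁻¹ • q.2) := measurable_toSimplex.comp (by fun_prop)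
  have hr : Measurable fun q : ((ℝ × ℝ × EuclideanSpace ℝ ι) × ℝ) × EuclideanSpace ℝ ι =>
      q.1.1.1 := by fun_prop
  have hcont : Measurable fun q : ((ℝ × ℝ × EuclideanSpace ℝ ι) × ℝ) × EuclideanSpace ℝ ι =>
      refine P x q.1.1.1 j (nextRadius P q.1.1.1 q.1.1.2.1) (toSimplex ((P.M : ℝ)⁻¹ • q.2)) :=
    h.comp (hr.prodMk ((hR.comp measurable_fst).prodMk hS))
  unfold refineBranch
  refine Measurable.ite (measurableSet_lt (by fun_prop) (by fun_prop)) hd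
    (Measurable.ite (measurableSet_lt (by fun_prop) hR) hd ?_)
  exact measurable_bind_uncurry (measurable_gaussianVec.comp
    (hs.prodMk ((hR.const_mul 2).mul_const P.σ₁))) hcont

/-- Joint in target radius, current radius and center: the induction changes the last two, and the
aggregation integrates over the first. -/
lemma measurable_refine (j : ℕ) :
    Measurable fun q : ℝ × ℝ × EuclideanSpace ℝ ι => refine P x q.1 j q.2.1 q.2.2 := by
  induction j with
  | zero => exact Measure.measurable_dirac.comp (by fun_prop)
  | succ j ih =>
    simp_rw [refine_succ]
    refine measurable_bind_uncurry ?_ (measurable_refineBranch ih)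
    have hR : Measurable fun q : ℝ × ℝ × EuclideanSpace ℝ ι => nextRadius P q.1 q.2.1 :=
      (measurable_nextRadius P).comp (by fun_prop : Measurable fun q :
        ℝ × ℝ × EuclideanSpace ℝ ι => (q.1, q.2.1))
    have hc : Measurable fun q : ℝ × ℝ × EuclideanSpace ℝ ι => q.2.2 := by fun_prop
    have hn := (measurable_count x).comp (hc.prodMk hR)
    exact measurable_gaussianReal.comp (hn.prodMk measurable_const)

lemma measurable_refineBranch_right (r : ℝ) (j : ℕ) (R : ℝ) (c : EuclideanSpace ℝ ι) :
    Measurable (refineBranch P x r j R c) :=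
  (measurable_refineBranch (measurable_refine P x j)).comp
    (measurable_prodMk_left (x := ((r, R, c) : ℝ × ℝ × EuclideanSpace ℝ ι)))

lemma measurable_refine_toSimplex (r : ℝ) (j : ℕ) (R : ℝ) :
    Measurable fun s => refine P x r j R (toSimplex ((P.M : ℝ)⁻¹ • s)) :=
  (measurable_refine P x j).comp (Measurable.prodMk measurable_const
    (Measurable.prodMk measurable_const (measurable_toSimplex.comp (by fun_prop))))

lemma isProbabilityMeasure_refine (r : ℝ) (j : ℕ) (R : ℝ) (c : EuclideanSpace ℝ ι) :
    IsProbabilityMeasure (refine P x r j R c) := by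
  induction j generalizing R c with
  | zero => rw [refine]; infer_instance
  | succ j ih =>
    rw [refine_succ]
    refine isProbabilityMeasure_bind' (measurable_refineBranch_right P x r j R c) fun t => ?_
    unfold refineBranch
    split_ifs
    · infer_instance
    · infer_instance
    · exact isProbabilityMeasure_bind' (measurable_refine_toSimplex P x r j _) fun s => ih _ _

lemma τ₁_nonneg (α : ℕ) : 0 ≤ τ₁ P α := by unfold τ₁; positivity

lemma τ₂_nonneg (α : ℕ) : 0 ≤ τ₂ P α := by unfold τ₂; positivity

variable {P x} {x' : Fin P.M → EuclideanSpace ℝ ι} {i₀ : Fin P.M}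

lemma nextRadius_pos (hlam : 0 ≤ P.lam) (hσ₁ : 0 < P.σ₁) {r R : ℝ} (hr : 0 < r) (hR : 0 < R) :
    0 < nextRadius P r R := by
  unfold nextRadius
  positivity

/-- The radius and center are earlier outputs, hence common to both runs. The count has sensitivity
1; the clipped points lie in one ball of the new radius, so their sum moves by at most its diameter,
and the noise scale is `σ₁` times that diameter. -/
lemma renyiLE_refine (hlam : 0 ≤ P.lam) (hσ₁ : 0 < P.σ₁) (hσ₂ : 0 < P.σ₂) {α : ℕ} (hα : 2 ≤ α)
    (hx : ∀ i, i ≠ i₀ → x i = x' i) {r : ℝ} (hr : 0 < r) (j : ℕ) {R : ℝ} (hR : 0 < R)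
    (c : EuclideanSpace ℝ ι) :
    RenyiLE α (j * (τ₁ P α + τ₂ P α)) (refine P x r j R c) (refine P x' r j R c) := by
  have ha : (1 : ℝ) < α := by exact_mod_cast hα
  have h1 := τ₁_nonneg P α
  have h2 := τ₂_nonneg P α
  induction j generalizing R c with
  | zero => exact RenyiLE.refl ha (by simp) (Measure.dirac c)
  | succ j ih =>
    rw [refine_succ, refine_succ]
    refine RenyiLE.mono (τ := τ₂ P α + (τ₁ P α + j * (τ₁ P α + τ₂ P α))) ?_
      (by push_cast; linarith)
    refine RenyiLE.bind ?_ (measurable_refineBranch_right P x r j R c)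
      (measurable_refineBranch_right P x' r j R c) (Filter.Eventually.of_forall fun t => ?_)
    · refine RenyiLE.gaussianReal ha _ _ (Real.toNNReal_pos.2 (by positivity)).ne' ?_
      rw [Real.coe_toNNReal _ (sq_nonneg _), τ₂]
      have h4 : ((count x c (nextRadius P r R) : ℝ) - count x' c (nextRadius P r R)) ^ 2 ≤ 1 :=
        (sq_le_one_iff_abs_le_one _).2 (abs_count_sub_le hx _ _)
      gcongr
      exact mul_le_of_le_one_right (by positivity) h4
    · have hpos := nextRadius_pos hlam hσ₁ hr hR
      unfold refineBranch
      split_ifs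
      · exact RenyiLE.refl ha (by positivity) _
      · exact RenyiLE.refl ha (by positivity) _
      · refine RenyiLE.bind ?_ (measurable_refine_toSimplex P x r j _)
          (measurable_refine_toSimplex P x' r j _) (Filter.Eventually.of_forall fun s => ih hpos _)
        refine RenyiLE.gaussianVec ha _ _ (by positivity) ?_
        rw [norm_sum_sub_sum (i₀ := i₀) (fun i hi => by rw [hx i hi]), τ₁]
        have h5 : ‖clip c (nextRadius P r R) (x i₀) - clip c (nextRadius P r R) (x' i₀)‖ ≤
            2 * nextRadius P r R := by
          rw [← sub_sub_sub_cancel_right _ _ c]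
          refine (norm_sub_le _ _).trans ?_
          linarith [norm_clip_sub_le c hpos (x i₀), norm_clip_sub_le c hpos (x' i₀)]
        calc _ ≤ (α : ℝ) * (2 * nextRadius P r R) ^ 2 / (2 * (2 * nextRadius P r R * P.σ₁) ^ 2) := by
              gcongr
          _ = _ := by field_simp

/-! ### The private aggregation -/

variable (P x) in
/-- The law of the aggregation given the target radius. -/
def aggregateAt (r : ℝ) : Measure (EuclideanSpace ℝ ι) :=
  (gaussianVec (∑ i, x i) (2 * (√2 / 2) * P.σ₁)).bind fun s =>
    refine P x r P.That (√2 / 2) (toSimplex ((P.M : ℝ)⁻¹ • s))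

lemma aggregate_eq : aggregate P x =
    (goodRadius x ⌈P.ρ * P.M⌉₊ P.σ₀ P.θ).bind (aggregateAt P x) := rfl

lemma measurable_aggregateAt : Measurable (aggregateAt P x) := by
  unfold aggregateAt
  refine measurable_bind_uncurry measurable_const ?_
  exact (measurable_refine P x P.That).comp (Measurable.prodMk measurable_fst
    (Measurable.prodMk measurable_const (measurable_toSimplex.comp (by fun_prop))))

variable (P x) in
lemma isProbabilityMeasure_aggregate : IsProbabilityMeasure (aggregate P x) := by
  have := isProbabilityMeasure_searchLoop (scoreL x ⌈P.ρ * P.M⌉₊) ⌈P.ρ * P.M⌉₊ P.σ₀ P.θ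
    (searchSteps P.θ) 0 (√2 / 2)
  rw [aggregate_eq, goodRadius]
  refine isProbabilityMeasure_bind' measurable_aggregateAt fun r => ?_
  exact isProbabilityMeasure_bind' (measurable_refine_toSimplex P x r _ _) fun s =>
    isProbabilityMeasure_refine P x _ _ _ _

lemma stepRDP_nonneg (P : Params) (α : ℕ) : 0 ≤ stepRDP P α := by
  have h1 := τ₁_nonneg P α
  have h2 := τ₂_nonneg P α
  unfold stepRDP τ₀
  positivity

lemma renyiLE_aggregate (hlam : 0 ≤ P.lam) (hσ₀ : 0 < P.σ₀) (hσ₁ : 0 < P.σ₁) (hσ₂ : 0 < P.σ₂)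
    {α : ℕ} (hα : 2 ≤ α) (hx : ∀ i, i ≠ i₀ → x i = x' i) (h0 : ‖x i₀ - x' i₀‖ ≤ √2) :
    RenyiLE α (stepRDP P α) (aggregate P x) (aggregate P x') := by
  have ha : (1 : ℝ) < α := by exact_mod_cast hα
  rw [aggregate_eq, aggregate_eq]
  refine RenyiLE.mono (τ := τ₀ P α + (τ₁ P α + P.That * (τ₁ P α + τ₂ P α))) ?_
    (by rw [stepRDP]; linarith)
  refine RenyiLE.bind (renyiLE_searchLoop _ _ _ ha hσ₀ (fun s => abs_scoreL_sub_le hx _ s) _ _ _)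
    measurable_aggregateAt measurable_aggregateAt ?_
  filter_upwards [ae_searchLoop_pos _ _ _ _ _ le_rfl (by positivity)] with r hr
  refine RenyiLE.bind ?_ (measurable_refine_toSimplex P x r _ _)
    (measurable_refine_toSimplex P x' r _ _) (Filter.Eventually.of_forall fun s =>
      renyiLE_refine hlam hσ₁ hσ₂ hα hx hr _ (by positivity) _)
  -- The initial mean is unclipped: the distance bound `√2` plays the role of the diameter `2R` at
  -- `R = √2 / 2`.
  refine RenyiLE.gaussianVec ha _ _ (by positivity) ?_
  rw [norm_sum_sub_sum hx, τ₁]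
  calc _ ≤ (α : ℝ) * √2 ^ 2 / (2 * (2 * (√2 / 2) * P.σ₁) ^ 2) := by gcongr
    _ = _ := by field_simp

end Points

/-! ### Amplification by subsampling, for laws on a finite set -/

section Amplification

/-- Absolute continuity at atoms, by testing with the indicator of `{x}`. It makes the convention `0
/ 0 = 0` harmless in the sums below. -/
lemma RenyiLE.eq_zero {Ω : Type*} [MeasurableSpace Ω] [MeasurableSingletonClass Ω] {a τ : ℝ} (ha : 1 < a)
    {μ ν : Measure Ω} [IsFiniteMeasure μ] [IsFiniteMeasure ν] (h : RenyiLE a τ μ ν) (x : Ω) (hx : ν.real {x} = 0) : μ.real {x} = 0 := by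
  have hq : 0 < a.conjExponent := (Real.HolderConjugate.conjExponent ha).symm.pos
  have h1 := h (Set.indicator {x} 1) (measurable_one.indicator (measurableSet_singleton x))
  have h2 : ∀ y, Set.indicator {x} (1 : Ω → ℝ≥0∞) y ^ a.conjExponent = Set.indicator {x} 1 y := by
    intro y
    by_cases hy : y ∈ ({x} : Set Ω)
    · rw [Set.indicator_of_mem hy]; simp
    · rw [Set.indicator_of_notMem hy, ENNReal.zero_rpow_of_pos hq]
  simp_rw [h2] at h1
  rw [lintegral_indicator_one (measurableSet_singleton x),
    lintegral_indicator_one (measurableSet_singleton x), (measureReal_eq_zero_iff).1 hx,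
    mul_zero, nonpos_iff_eq_zero, ENNReal.rpow_eq_zero_iff_of_pos hq] at h1
  rwa [measureReal_eq_zero_iff]

lemma mul_div_pow_succ {a b : ℝ} (hb : b ≠ 0) (i : ℕ) :
    b * (a / b) ^ (i + 1) = a ^ (i + 1) / b ^ i := by
  rw [div_pow, pow_succ b]
  field_simp

variable {Ω : Type*} [Fintype Ω]

/-- Joint convexity of `a ^ j / b ^ (j - 1)`: Jensen for the `j`-th power of the ratios `a k / b k`
with weights proportional to `w k * b k`. -/
lemma pow_sum_div_pow_sum_le {κ : Type*} [Fintype κ] {w a b : κ → ℝ} (hw : ∀ k, 0 ≤ w k)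
    (ha : ∀ k, 0 ≤ a k) (hb : ∀ k, 0 ≤ b k) (hab : ∀ k, b k = 0 → a k = 0) {j : ℕ} (hj : 2 ≤ j) :
    (∑ k, w k * a k) ^ j / (∑ k, w k * b k) ^ (j - 1) ≤
      ∑ k, w k * (a k ^ j / b k ^ (j - 1)) := by
  have hwb : ∀ k, 0 ≤ w k * b k := fun k => mul_nonneg (hw k) (hb k)
  have hY : 0 ≤ ∑ k, w k * (a k ^ j / b k ^ (j - 1)) := Finset.sum_nonneg fun k _ =>
    mul_nonneg (hw k) (div_nonneg (pow_nonneg (ha k) _) (pow_nonneg (hb k) _))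
  rcases (Finset.sum_nonneg fun k _ => hwb k : 0 ≤ ∑ k, w k * b k).eq_or_lt with hS | hS
  · rw [← hS, zero_pow (by omega), div_zero]
    exact hY
  set S := ∑ k, w k * b k with hSdef
  have h := Real.pow_arith_mean_le_arith_mean_pow Finset.univ (fun k => w k * b k / S)
    (fun k => a k / b k) (fun k _ => div_nonneg (hwb k) hS.le)
    (by rw [← Finset.sum_div, ← hSdef, div_self hS.ne'])
    (fun k _ => div_nonneg (ha k) (hb k)) j
  have e1 : ∑ k, w k * b k / S * (a k / b k) = (∑ k, w k * a k) / S := by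
    rw [Finset.sum_div]
    refine Finset.sum_congr rfl fun k _ => ?_
    rcases eq_or_ne (b k) 0 with h0 | h0
    · simp [h0, hab k h0]
    · field_simp
  obtain ⟨i, rfl⟩ : ∃ i, j = i + 1 := ⟨j - 1, by omega⟩
  have e2 : ∑ k, w k * b k / S * (a k / b k) ^ (i + 1) =
      (∑ k, w k * (a k ^ (i + 1) / b k ^ i)) / S := by
    rw [Finset.sum_div]
    refine Finset.sum_congr rfl fun k _ => ?_
    rcases eq_or_ne (b k) 0 with h0 | h0
    · simp [h0, hab k h0]
    · rw [← mul_div_pow_succ h0]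
      ring
  rw [e1, e2, div_pow, pow_succ S, ← div_div, div_le_div_iff_of_pos_right hS] at h
  exact h

lemma abs_sub_pow_le {p q : ℝ} (hp : 0 ≤ p) (hq : 0 ≤ q) (j : ℕ) :
    |p - q| ^ j ≤ p ^ j + q ^ j := by
  rcases le_total p q with h | h
  · rw [abs_of_nonpos (by linarith)]
    have : (-(p - q)) ^ j ≤ q ^ j := pow_le_pow_left₀ (by linarith) (by linarith) _
    linarith [pow_nonneg hp j]
  · rw [abs_of_nonneg (by linarith)]
    have : (p - q) ^ j ≤ p ^ j := pow_le_pow_left₀ (by linarith) (by linarith) _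
    linarith [pow_nonneg hq j]

lemma sum_abs_sub_pow_div_le {p q r : Ω → ℝ} (hp : ∀ x, 0 ≤ p x) (hq : ∀ x, 0 ≤ q x)
    (hr : ∀ x, 0 ≤ r x) (j : ℕ) {C : ℝ} (h1 : ∑ x, p x ^ j / r x ^ (j - 1) ≤ C)
    (h2 : ∑ x, q x ^ j / r x ^ (j - 1) ≤ C) :
    ∑ x, |p x - q x| ^ j / r x ^ (j - 1) ≤ C * 2 := by
  have : ∑ x, |p x - q x| ^ j / r x ^ (j - 1) ≤
      ∑ x, (p x ^ j / r x ^ (j - 1) + q x ^ j / r x ^ (j - 1)) := by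
    refine Finset.sum_le_sum fun x _ => ?_
    rw [← add_div]
    exact div_le_div_of_nonneg_right (abs_sub_pow_le (hp x) (hq x) j) (pow_nonneg (hr x) _)
  rw [Finset.sum_add_distrib] at this
  linarith

lemma sum_sub_sq_div_eq {p r : Ω → ℝ} (hp : ∑ x, p x = 1) (hr : ∑ x, r x = 1)
    (hpr : ∀ x, r x = 0 → p x = 0) :
    ∑ x, (p x - r x) ^ 2 / r x = ∑ x, p x ^ 2 / r x - 1 := by
  have : ∀ x, (p x - r x) ^ 2 / r x = p x ^ 2 / r x - 2 * p x + r x := by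
    intro x
    rcases eq_or_ne (r x) 0 with h0 | h0
    · simp [h0, hpr x h0]
    · field_simp
      ring
  simp_rw [this]
  rw [Finset.sum_add_distrib, Finset.sum_sub_distrib, ← Finset.mul_sum, hp, hr]
  ring

/-- Compare both with `r` through `(p - q)² ≤ 2 (p - r)² + 2 (q - r)²`; each chi-square divergence
from `r` is a second moment minus 1. This bound is the better one for small `τ 2`. -/
lemma sum_abs_sub_sq_div_le {p q r : Ω → ℝ} (hr : ∀ x, 0 ≤ r x) (hp1 : ∑ x, p x = 1)
    (hq1 : ∑ x, q x = 1) (hr1 : ∑ x, r x = 1) (hpr : ∀ x, r x = 0 → p x = 0)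
    (hqr : ∀ x, r x = 0 → q x = 0) {C : ℝ} (h1 : ∑ x, p x ^ 2 / r x ≤ C)
    (h2 : ∑ x, q x ^ 2 / r x ≤ C) : ∑ x, |p x - q x| ^ 2 / r x ≤ 4 * (C - 1) := by
  have : ∑ x, |p x - q x| ^ 2 / r x ≤
      ∑ x, (2 * ((p x - r x) ^ 2 / r x) + 2 * ((q x - r x) ^ 2 / r x)) := by
    refine Finset.sum_le_sum fun x _ => ?_
    rw [← mul_div_assoc, ← mul_div_assoc, ← add_div, sq_abs]
    refine div_le_div_of_nonneg_right ?_ (hr x)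
    nlinarith [sq_nonneg ((p x - r x) + (q x - r x))]
  rw [Finset.sum_add_distrib, ← Finset.mul_sum, ← Finset.mul_sum, sum_sub_sq_div_eq hp1 hr1 hpr,
    sum_sub_sq_div_eq hq1 hr1 hqr] at this
  linarith

/-- Binomial expansion of the `α`-th power of `1 + (P - Q) / Q` under `Q`. The linear term vanishes
because both masses are 1, so the amplified bound starts at order `γ ^ 2`. -/
lemma sum_pow_div_le_binomial {α : ℕ} (hα : 2 ≤ α) {P Q : Ω → ℝ} (hQ0 : ∀ x, 0 ≤ Q x)
    (hP : ∑ x, P x = 1) (hQ : ∑ x, Q x = 1) (hac : ∀ x, Q x = 0 → P x = 0) {B : ℕ → ℝ}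
    (hB : ∀ j, 2 ≤ j → j ≤ α → ∑ x, |P x - Q x| ^ j / Q x ^ (j - 1) ≤ B j) :
    ∑ x, P x ^ α / Q x ^ (α - 1) ≤
      1 + α.choose 2 * B 2 + ∑ j ∈ Finset.Icc 3 α, α.choose j * B j := by
  have e : ∀ x, P x ^ α / Q x ^ (α - 1) =
      ∑ j ∈ Finset.range (α + 1), α.choose j * (Q x * ((P x - Q x) / Q x) ^ j) := by
    intro x
    rcases eq_or_ne (Q x) 0 with h0 | h0
    · rw [h0, hac x h0, zero_pow (by omega : α - 1 ≠ 0)]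
      simp
    · have : P x ^ α / Q x ^ (α - 1) = Q x * ((P x - Q x) / Q x + 1) ^ α := by
        obtain ⟨i, rfl⟩ : ∃ i, α = i + 1 := ⟨α - 1, by omega⟩
        rw [show (P x - Q x) / Q x + 1 = P x / Q x by field_simp; ring, mul_div_pow_succ h0,
          Nat.add_sub_cancel]
      rw [this, add_pow, Finset.mul_sum]
      refine Finset.sum_congr rfl fun j _ => ?_
      rw [one_pow]
      ring
  have hle : ∀ j, 1 ≤ j → ∑ x, Q x * ((P x - Q x) / Q x) ^ j ≤
      ∑ x, |P x - Q x| ^ j / Q x ^ (j - 1) := by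
    intro j hj
    refine Finset.sum_le_sum fun x _ => (le_abs_self _).trans (le_of_eq ?_)
    rw [abs_mul, abs_pow, abs_div, abs_of_nonneg (hQ0 x)]
    obtain ⟨i, rfl⟩ : ∃ i, j = i + 1 := ⟨j - 1, by omega⟩
    rcases eq_or_ne (Q x) 0 with h0 | h0
    · simp [h0, hac x h0]
    · rw [mul_div_pow_succ h0, Nat.add_sub_cancel]
  simp_rw [e]
  rw [Finset.sum_comm]
  simp_rw [← Finset.mul_sum]
  have h1 : ∑ x, Q x * ((P x - Q x) / Q x) ^ 1 = 0 := by
    have : ∀ x, Q x * ((P x - Q x) / Q x) ^ 1 = P x - Q x := by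
      intro x
      rcases eq_or_ne (Q x) 0 with h0 | h0
      · simp [h0, hac x h0]
      · field_simp
    simp_rw [this]
    rw [Finset.sum_sub_distrib, hP, hQ, sub_self]
  rw [Finset.range_eq_Ico, Finset.sum_eq_sum_Ico_succ_bot (by omega),
    Finset.sum_eq_sum_Ico_succ_bot (by omega), Finset.sum_eq_sum_Ico_succ_bot (by omega), h1]
  have h2 := (hle 2 (by omega)).trans (hB 2 le_rfl hα)
  have h3 : ∑ j ∈ Finset.Ico 3 (α + 1), (α.choose j : ℝ) * ∑ x, Q x * ((P x - Q x) / Q x) ^ j ≤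
      ∑ j ∈ Finset.Icc 3 α, α.choose j * B j := by
    rw [show Finset.Ico 3 (α + 1) = Finset.Icc 3 α by ext; simp]
    refine Finset.sum_le_sum fun j hj => ?_
    rw [Finset.mem_Icc] at hj
    exact mul_le_mul_of_nonneg_left ((hle j (by omega)).trans (hB j (by omega) hj.2))
      (Nat.cast_nonneg _)
  have h2' := mul_le_mul_of_nonneg_left h2 (Nat.cast_nonneg (α := ℝ) (α.choose 2))
  simp only [Nat.choose_zero_right, Nat.cast_one, pow_zero, mul_one, hQ, mul_zero,
    zero_add, Nat.reduceAdd]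
  linarith

variable [MeasurableSpace Ω] [MeasurableSingletonClass Ω]

lemma sum_measureReal_singleton_eq_one (μ : Measure Ω) [IsProbabilityMeasure μ] :
    ∑ x, μ.real {x} = 1 := by
  rw [sum_measureReal_singleton, Finset.coe_univ, probReal_univ]

lemma lintegral_ofReal_fintype (μ : Measure Ω) [IsFiniteMeasure μ] {f : Ω → ℝ}
    (hf : ∀ x, 0 ≤ f x) :
    ∫⁻ x, ENNReal.ofReal (f x) ∂μ = ENNReal.ofReal (∑ x, f x * μ.real {x}) := by
  rw [lintegral_fintype, ENNReal.ofReal_sum_of_nonneg fun x _ =>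
    mul_nonneg (hf x) measureReal_nonneg]
  refine Finset.sum_congr rfl fun x _ => ?_
  rw [ENNReal.ofReal_mul (hf x), ofReal_measureReal]

/-- The extremal function of Hölder's inequality, the ratio to the power `j - 1`, makes both
integrals equal to the sum `Z`. Then `Z ^ (j / (j - 1)) ≤ e^τ Z` is solved for `Z`. -/
lemma RenyiLE.sum_pow_div_le {j : ℕ} (hj : 2 ≤ j) {τ : ℝ} {μ ν : Measure Ω}
    [IsProbabilityMeasure μ] [IsProbabilityMeasure ν] (h : RenyiLE j τ μ ν) :
    ∑ x, μ.real {x} ^ j / ν.real {x} ^ (j - 1) ≤ Real.exp ((j - 1) * τ) := by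
  have ha : (1 : ℝ) < j := by exact_mod_cast hj
  have hj1 : (0 : ℝ) < j - 1 := by linarith
  obtain ⟨i, rfl⟩ : ∃ i, j = i + 1 := ⟨j - 1, by omega⟩
  simp only [Nat.add_sub_cancel, Nat.cast_add, Nat.cast_one, add_sub_cancel_right] at *
  have hf0 : ∀ x, 0 ≤ (μ.real {x} / ν.real {x}) ^ i := fun x => by positivity
  have h1 := h (fun x => ENNReal.ofReal ((μ.real {x} / ν.real {x}) ^ i))
    (measurable_of_finite _)
  have hq : 0 < ((i : ℝ) + 1).conjExponent := (Real.HolderConjugate.conjExponent ha).symm.pos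
  have hi : (i : ℝ) ≠ 0 := hj1.ne'
  have hqe : ((i : ℝ) + 1).conjExponent = (i + 1) / i := by
    rw [Real.conjExponent, add_sub_cancel_right]
  have e1 : ∀ x, ENNReal.ofReal ((μ.real {x} / ν.real {x}) ^ i) ^ ((i : ℝ) + 1).conjExponent =
      ENNReal.ofReal ((μ.real {x} / ν.real {x}) ^ (i + 1)) := by
    intro x
    rw [ENNReal.ofReal_rpow_of_nonneg (hf0 x) hq.le, ← Real.rpow_natCast, ← Real.rpow_mul
      (by positivity), ← Real.rpow_natCast, hqe]
    congr 2
    push_cast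
    field_simp
  simp_rw [e1] at h1
  rw [lintegral_ofReal_fintype μ hf0, lintegral_ofReal_fintype ν fun x => by positivity] at h1
  have e2 : ∑ x, (μ.real {x} / ν.real {x}) ^ i * μ.real {x} =
      ∑ x, μ.real {x} ^ (i + 1) / ν.real {x} ^ i :=
    Finset.sum_congr rfl fun x _ => by rw [div_pow, pow_succ, div_mul_eq_mul_div]
  have e3 : ∑ x, (μ.real {x} / ν.real {x}) ^ (i + 1) * ν.real {x} =
      ∑ x, μ.real {x} ^ (i + 1) / ν.real {x} ^ i := by
    refine Finset.sum_congr rfl fun x _ => ?_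
    rcases eq_or_ne (ν.real {x}) 0 with h0 | h0
    · have : i ≠ 0 := by exact_mod_cast hi
      simp [h0, this]
    · rw [mul_comm, mul_div_pow_succ h0]
  rw [e2, e3] at h1
  set Z := ∑ x, μ.real {x} ^ (i + 1) / ν.real {x} ^ i with hZ
  have hZ0 : 0 ≤ Z := Finset.sum_nonneg fun x _ => by positivity
  rcases hZ0.eq_or_lt with h0 | h0
  · rw [← h0]; positivity
  rw [ENNReal.ofReal_rpow_of_nonneg hZ0 hq.le, ← ENNReal.ofReal_mul (Real.exp_pos _).le,
    ENNReal.ofReal_le_ofReal_iff (by positivity), hqe, add_div, div_self hi,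
    Real.rpow_add h0, Real.rpow_one, mul_comm] at h1
  have h2 := le_of_mul_le_mul_right h1 h0
  have h3 := Real.rpow_le_rpow (by positivity) h2 hj1.le
  rw [← Real.rpow_mul hZ0, one_div_mul_cancel hi, Real.rpow_one, ← Real.exp_mul] at h3
  rwa [mul_comm]

lemma RenyiLE.of_sum_pow_div_le {α : ℕ} (hα : 2 ≤ α) {τ : ℝ} {μ ν : Measure Ω}
    [IsProbabilityMeasure μ] [IsProbabilityMeasure ν]
    (hac : ∀ x, ν.real {x} = 0 → μ.real {x} = 0)
    (h : ∑ x, μ.real {x} ^ α / ν.real {x} ^ (α - 1) ≤ Real.exp ((α - 1) * τ)) :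
    RenyiLE α τ μ ν := by
  have ha : (1 : ℝ) < α := by exact_mod_cast hα
  refine RenyiLE.of_density ha (h := fun x => ENNReal.ofReal (μ.real {x} / ν.real {x}))
    (measurable_of_finite _) ?_ ?_
  · refine Measure.ext_of_singleton fun x => ?_
    rw [withDensity_apply _ (measurableSet_singleton x), lintegral_singleton,
      ← ofReal_measureReal (μ := ν), ← ofReal_measureReal (μ := μ),
      ← ENNReal.ofReal_mul (by positivity)]
    rcases eq_or_ne (ν.real {x}) 0 with h0 | h0
    · simp [h0, hac x h0]
    · rw [div_mul_cancel₀ _ h0]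
  · have e1 : ∀ x, ENNReal.ofReal (μ.real {x} / ν.real {x}) ^ (α : ℝ) =
        ENNReal.ofReal ((μ.real {x} / ν.real {x}) ^ α) := by
      intro x
      rw [ENNReal.rpow_natCast, ENNReal.ofReal_pow (by positivity)]
    simp_rw [e1]
    rw [lintegral_ofReal_fintype ν fun x => by positivity]
    refine ENNReal.ofReal_le_ofReal (le_trans (le_of_eq ?_) h)
    refine Finset.sum_congr rfl fun x _ => ?_
    obtain ⟨i, rfl⟩ : ∃ i, α = i + 1 := ⟨α - 1, by omega⟩
    rcases eq_or_ne (ν.real {x}) 0 with h0 | h0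
    · simp [h0, hac x h0]
    · rw [mul_comm, mul_div_pow_succ h0, Nat.add_sub_cancel]

/-- Amplification by subsampling: if `Q` is a mixture of the laws `r k`, and `P - Q` is `g ≤ γ`
times the corresponding mixture of the differences `p k - q k`, then Rényi bounds for `p k` and
`q k` relative to `r k` give the amplified bound for `P` relative to `Q`. -/
theorem RenyiLE.subsample {κ : Type*} [Fintype κ] {w : κ → ℝ} (hw : ∀ k, 0 ≤ w k)
    (hw1 : ∑ k, w k = 1) {p q r : κ → Measure Ω} [∀ k, IsProbabilityMeasure (p k)]
    [∀ k, IsProbabilityMeasure (q k)] [∀ k, IsProbabilityMeasure (r k)] {P Q : Measure Ω}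
    [IsProbabilityMeasure P] [IsProbabilityMeasure Q] {g γ : ℝ} (hg : 0 ≤ g) (hgγ : g ≤ γ)
    (hPQ : ∀ x, P.real {x} - Q.real {x} = g * ∑ k, w k * ((p k).real {x} - (q k).real {x}))
    (hQ : ∀ x, Q.real {x} = ∑ k, w k * (r k).real {x}) {τ : ℕ → ℝ} (hτ : 0 ≤ τ 2) {α : ℕ}
    (hα : 2 ≤ α) (hp : ∀ j : ℕ, 2 ≤ j → ∀ k, RenyiLE j (τ j) (p k) (r k))
    (hq : ∀ j : ℕ, 2 ≤ j → ∀ k, RenyiLE j (τ j) (q k) (r k)) :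
    RenyiLE α (subsampledRDP γ τ α) P Q := by
  have hpr : ∀ k x, (r k).real {x} = 0 → (p k).real {x} = 0 := fun k x =>
    (hp 2 le_rfl k).eq_zero (by norm_num) x
  have hqr : ∀ k x, (r k).real {x} = 0 → (q k).real {x} = 0 := fun k x =>
    (hq 2 le_rfl k).eq_zero (by norm_num) x
  have hac : ∀ x, Q.real {x} = 0 → P.real {x} = 0 := by
    intro x hx
    have h0 : ∀ k, w k * (r k).real {x} = 0 := by
      have := (Finset.sum_eq_zero_iff_of_nonneg (s := Finset.univ) fun k _ =>
        mul_nonneg (hw k) (measureReal_nonneg (μ := r k) (s := {x}))).1 ((hQ x).symm.trans hx)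
      exact fun k => this k (Finset.mem_univ k)
    have h1 := hPQ x
    rw [Finset.sum_eq_zero, mul_zero, hx, sub_zero] at h1
    · exact h1
    · intro k _
      rcases mul_eq_zero.1 (h0 k) with h | h
      · rw [h, zero_mul]
      · rw [hpr k x h, hqr k x h, sub_self, mul_zero]
  -- Joint convexity passes from the mixtures to their components, and the factor `g ≤ γ` comes out
  -- to the power `j`.
  have hχ : ∀ j, 2 ≤ j → ∀ C : ℝ,
      (∀ k, ∑ x, |(p k).real {x} - (q k).real {x}| ^ j / (r k).real {x} ^ (j - 1) ≤ C) →
      ∑ x, |P.real {x} - Q.real {x}| ^ j / Q.real {x} ^ (j - 1) ≤ γ ^ j * C := by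
    intro j hj C hC
    have h1 : ∀ x, |P.real {x} - Q.real {x}| ^ j / Q.real {x} ^ (j - 1) ≤
        γ ^ j * ∑ k, w k *
          (|(p k).real {x} - (q k).real {x}| ^ j / (r k).real {x} ^ (j - 1)) := by
      intro x
      have h2 := pow_sum_div_pow_sum_le hw
        (fun k => abs_nonneg ((p k).real {x} - (q k).real {x}))
        (fun k => measureReal_nonneg (μ := r k) (s := {x}))
        (fun k hk => by rw [hpr k x hk, hqr k x hk, sub_self, abs_zero]) hj
      rw [← hQ x] at h2
      refine le_trans ?_ (mul_le_mul_of_nonneg_left h2 (pow_nonneg (hg.trans hgγ) j))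
      rw [← mul_div_assoc, ← mul_pow]
      gcongr
      rw [hPQ x, abs_mul, abs_of_nonneg hg]
      refine mul_le_mul hgγ ?_ (abs_nonneg _) (hg.trans hgγ)
      refine (Finset.abs_sum_le_sum_abs _ _).trans (le_of_eq ?_)
      exact Finset.sum_congr rfl fun k _ => by rw [abs_mul, abs_of_nonneg (hw k)]
    refine (Finset.sum_le_sum fun x _ => h1 x).trans ?_
    rw [← Finset.mul_sum, Finset.sum_comm]
    simp_rw [← Finset.mul_sum]
    refine mul_le_mul_of_nonneg_left ?_ (pow_nonneg (hg.trans hgγ) j)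
    calc _ ≤ ∑ k, w k * C := Finset.sum_le_sum fun k _ => mul_le_mul_of_nonneg_left (hC k) (hw k)
      _ = C := by rw [← Finset.sum_mul, hw1, one_mul]
  have h2 : ∀ k, ∑ x, |(p k).real {x} - (q k).real {x}| ^ 2 / (r k).real {x} ^ (2 - 1) ≤
      min (4 * (Real.exp (τ 2) - 1)) (Real.exp (τ 2) * 2) := by
    intro k
    have b1 := (hp 2 le_rfl k).sum_pow_div_le le_rfl
    have b2 := (hq 2 le_rfl k).sum_pow_div_le le_rfl
    rw [show ((2 : ℕ) : ℝ) - 1 = 1 by norm_num, one_mul] at b1 b2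
    refine le_min ?_ (sum_abs_sub_pow_div_le (fun _ => measureReal_nonneg)
      (fun _ => measureReal_nonneg) (fun _ => measureReal_nonneg) 2 b1 b2)
    simp only [Nat.add_one_sub_one, pow_one] at b1 b2 ⊢
    exact sum_abs_sub_sq_div_le (fun _ => measureReal_nonneg)
      (sum_measureReal_singleton_eq_one _) (sum_measureReal_singleton_eq_one _)
      (sum_measureReal_singleton_eq_one _) (hpr k) (hqr k) b1 b2
  have h3 : ∀ j : ℕ, 3 ≤ j → ∀ k,
      ∑ x, |(p k).real {x} - (q k).real {x}| ^ j / (r k).real {x} ^ (j - 1) ≤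
        Real.exp ((j - 1) * τ j) * 2 := fun j hj k =>
    sum_abs_sub_pow_div_le (fun _ => measureReal_nonneg)
      (fun _ => measureReal_nonneg) (fun _ => measureReal_nonneg) j
      ((hp j (by omega) k).sum_pow_div_le (by omega))
      ((hq j (by omega) k).sum_pow_div_le (by omega))
  set B : ℕ → ℝ := fun j => γ ^ j * if j = 2 then
    min (4 * (Real.exp (τ 2) - 1)) (Real.exp (τ 2) * 2) else Real.exp ((j - 1) * τ j) * 2 with hBdef
  have hB : ∀ j, 2 ≤ j → j ≤ α →
      ∑ x, |P.real {x} - Q.real {x}| ^ j / Q.real {x} ^ (j - 1) ≤ B j := by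
    intro j hj _
    refine hχ j hj _ fun k => ?_
    split_ifs with h
    · subst h; exact h2 k
    · exact h3 j (by omega) k
  refine RenyiLE.of_sum_pow_div_le hα hac ?_
  refine (sum_pow_div_le_binomial hα (fun _ => measureReal_nonneg) (sum_measureReal_singleton_eq_one P)
    (sum_measureReal_singleton_eq_one Q) hac hB).trans ?_
  have ha1 : (0 : ℝ) < α - 1 := by
    have : (1 : ℝ) < α := by exact_mod_cast hα
    linarith
  have hγ := hg.trans hgγ
  have e3 : ∑ j ∈ Finset.Icc 3 α, (α.choose j : ℝ) * B j =
      ∑ j ∈ Finset.Icc 3 α, γ ^ j * (α.choose j) * Real.exp (((j : ℝ) - 1) * τ j) * 2 := by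
    refine Finset.sum_congr rfl fun j hj => ?_
    rw [Finset.mem_Icc] at hj
    rw [hBdef]
    simp only [if_neg (by omega : j ≠ 2)]
    ring
  have e2 : (α.choose 2 : ℝ) * B 2 =
      γ ^ 2 * (α.choose 2) * min (4 * (Real.exp (τ 2) - 1)) (Real.exp (τ 2) * 2) := by
    rw [hBdef]
    simp only [if_true]
    ring
  rw [e2, e3, subsampledRDP, ← mul_assoc, mul_one_div_cancel ha1.ne', one_mul, Real.exp_log]
  have hm : 0 ≤ min (4 * (Real.exp (τ 2) - 1)) (Real.exp (τ 2) * 2) :=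
    le_min (by linarith [Real.one_le_exp hτ]) (by positivity)
  positivity

end Amplification

/-! ### Uniform draws without replacement -/

section Draws

variable {σ β : Type*}

/-- The draw `d` with the element in slot `s` replaced by `none`. -/
def replaceByNone [DecidableEq σ] (s : σ) (d : σ ↪ β) : σ ↪ Option β where
  toFun := Function.update (fun x => some (d x)) s none
  inj' x x' h := by
    by_cases hx : x = s <;> by_cases hx' : x' = s
    · rw [hx, hx']
    · subst hx; simp [Function.update_of_ne hx'] at h
    · subst hx'; simp [Function.update_of_ne hx] at h
    · simpa [Function.update_of_ne hx, Function.update_of_ne hx'] using h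

lemma replaceByNone_self [DecidableEq σ] (s : σ) (d : σ ↪ β) : replaceByNone s d s = none := by
  change Function.update (fun x => some (d x)) s none s = none
  exact Function.update_self ..

lemma replaceByNone_of_ne [DecidableEq σ] {s x : σ} (h : x ≠ s) (d : σ ↪ β) :
    replaceByNone s d x = some (d x) := by
  change Function.update (fun x => some (d x)) s none x = some (d x)
  exact Function.update_of_ne h ..

lemma eq_of_replaceByNone_eq_none [DecidableEq σ] {s x : σ} {d : σ ↪ β}
    (h : replaceByNone s d x = none) : x = s := by
  by_contra hx
  rw [replaceByNone_of_ne hx] at h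
  exact Option.some_ne_none _ h

variable [Fintype σ] [DecidableEq σ] [Fintype β] [DecidableEq β]

/-- The slot must be the one where `e` is `none`, and the overwritten element can be anything
outside the range of `e`; the bijection records that element. -/
lemma card_filter_replaceByNone_eq {e : σ ↪ Option β} {s₀ : σ} (he : e s₀ = none) :
    (Finset.univ.filter fun k : σ × (σ ↪ β) => replaceByNone k.1 k.2 = e).card =
      Fintype.card β + 1 - Fintype.card σ := by
  have h1 : (Finset.univ.filter fun o : Option β => o ∉ Finset.univ.map e).card =
      Fintype.card β + 1 - Fintype.card σ := by
    rw [Finset.filter_notMem_eq_sdiff, Finset.card_sdiff_of_subset (Finset.subset_univ _),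
      Finset.card_map, Finset.card_univ, Finset.card_univ, Fintype.card_option]
  rw [← h1]
  refine Finset.card_bij (fun k _ => some (k.2 k.1)) ?_ ?_ ?_
  · rintro ⟨s, d⟩ hk
    simp only [Finset.mem_filter, Finset.mem_univ, true_and, Finset.mem_map, not_exists] at hk ⊢
    intro x hx
    rw [← hk] at hx
    by_cases hxs : x = s
    · rw [hxs, replaceByNone_self] at hx
      exact Option.some_ne_none _ hx.symm
    · rw [replaceByNone_of_ne hxs] at hx
      exact hxs (d.injective (Option.some.inj hx))
  · rintro ⟨s, d⟩ hk ⟨s', d'⟩ hk' h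
    simp only [Finset.mem_filter, Finset.mem_univ, true_and] at hk hk'
    have hs : s = s' := by
      have : replaceByNone s' d' s = none := by rw [hk', ← hk, replaceByNone_self]
      exact eq_of_replaceByNone_eq_none this
    subst hs
    have hd : d = d' := by
      ext x
      by_cases hx : x = s
      · rw [hx]; exact Option.some.inj h
      · have := DFunLike.congr_fun (hk.trans hk'.symm) x
        rw [replaceByNone_of_ne hx, replaceByNone_of_ne hx] at this
        exact Option.some.inj this
    rw [hd]
  · intro o ho
    simp only [Finset.mem_filter, Finset.mem_univ, true_and, Finset.mem_map, not_exists] at ho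
    obtain ⟨u, rfl⟩ : ∃ u, o = some u := by
      cases o with
      | none => exact absurd he (ho s₀)
      | some u => exact ⟨u, rfl⟩
    have hsome : ∀ x, x ≠ s₀ → e x = some ((e x).getD u) := by
      intro x hx
      cases hex : e x with
      | none => exact absurd (e.injective (hex.trans he.symm)) hx
      | some v => rfl
    have hinj : Function.Injective fun x => (e x).getD u := by
      intro x x' h
      simp only at h
      by_cases hx : x = s₀ <;> by_cases hx' : x' = s₀
      · rw [hx, hx']
      · rw [hx, he, Option.getD_none] at h
        exact absurd ((hsome x' hx').trans (by rw [← h])) (ho x')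
      · rw [hx', he, Option.getD_none] at h
        exact absurd ((hsome x hx).trans (by rw [h])) (ho x)
      · exact e.injective ((hsome x hx).trans ((congrArg some h).trans (hsome x' hx').symm))
    refine ⟨(s₀, ⟨_, hinj⟩), ?_, ?_⟩
    · simp only [Finset.mem_filter, Finset.mem_univ, true_and]
      ext1 x
      by_cases hx : x = s₀
      · rw [hx, replaceByNone_self, he]
      · rw [replaceByNone_of_ne hx]
        exact (hsome x hx).symm
    · simp [he]

/-- Split the draws by whether they contain `none`. Those that do are counted with constant
multiplicity by pairs of a slot and a draw from `β`; the identity is multiplied through by this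
multiplicity. -/
lemma sum_embedding_option (hcard : Fintype.card σ ≤ Fintype.card β) (F : (σ ↪ Option β) → ℝ) :
    ((Fintype.card β : ℝ) + 1 - Fintype.card σ) * ∑ e, F e =
      ((Fintype.card β : ℝ) + 1 - Fintype.card σ) *
        ∑ d : σ ↪ β, F (d.trans Function.Embedding.some) +
      ∑ k : σ × (σ ↪ β), F (replaceByNone k.1 k.2) := by
  have h1 : ∑ e ∈ Finset.univ.filter (fun e : σ ↪ Option β => ¬ ∃ s, e s = none), F e =
      ∑ d : σ ↪ β, F (d.trans Function.Embedding.some) := by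
    symm
    refine Finset.sum_bij (fun d _ => d.trans Function.Embedding.some) ?_ ?_ ?_ ?_
    · intro d _
      simp
    · intro d _ d' _ h
      ext x
      exact Option.some.inj (DFunLike.congr_fun h x)
    · intro e he
      simp only [Finset.mem_filter, Finset.mem_univ, true_and, not_exists] at he
      choose d hd using fun s => Option.ne_none_iff_exists'.1 (he s)
      refine ⟨⟨d, fun x x' h => e.injective (by rw [hd, hd, h])⟩, Finset.mem_univ _, ?_⟩
      ext1 x
      exact (hd x).symm
    · intro d _
      rfl
  have h2 : ∑ k : σ × (σ ↪ β), F (replaceByNone k.1 k.2) =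
      ((Fintype.card β : ℝ) + 1 - Fintype.card σ) *
        ∑ e ∈ Finset.univ.filter (fun e : σ ↪ Option β => ∃ s, e s = none), F e := by
    rw [← Finset.sum_fiberwise_of_maps_to (s := Finset.univ)
      (t := Finset.univ.filter fun e : σ ↪ Option β => ∃ s, e s = none)
      (g := fun k : σ × (σ ↪ β) => replaceByNone k.1 k.2), Finset.mul_sum]
    · refine Finset.sum_congr rfl fun e he => ?_
      obtain ⟨s₀, hs₀⟩ := (Finset.mem_filter.1 he).2
      rw [Finset.sum_congr rfl fun k hk => by rw [(Finset.mem_filter.1 hk).2],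
        Finset.sum_const, card_filter_replaceByNone_eq hs₀, nsmul_eq_mul,
        Nat.cast_sub (by omega)]
      push_cast
      rfl
    · intro k _
      simp only [Finset.mem_filter, Finset.mem_univ, true_and]
      exact ⟨k.1, replaceByNone_self _ _⟩
  rw [← Finset.sum_filter_add_sum_filter_not Finset.univ
    (fun e : σ ↪ Option β => ∃ s, e s = none) F, h1, h2]
  ring

/-- A uniform draw from `Option β` is a mixture of a uniform draw from `β` and a uniform draw from
`β` in which a uniformly random slot is replaced by `none`. -/
lemma average_embedding_option [Nonempty σ] (hcard : Fintype.card σ ≤ Fintype.card β)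
    (F : (σ ↪ Option β) → ℝ) {g : ℝ} (hg : g = Fintype.card σ / (Fintype.card β + 1)) :
    (Fintype.card (σ ↪ Option β) : ℝ)⁻¹ * ∑ e, F e =
      (1 - g) * ((Fintype.card (σ ↪ β) : ℝ)⁻¹ *
        ∑ d : σ ↪ β, F (d.trans Function.Embedding.some)) +
      g * ((Fintype.card (σ × (σ ↪ β)) : ℝ)⁻¹ *
        ∑ k : σ × (σ ↪ β), F (replaceByNone k.1 k.2)) := by
  -- The constant function yields the number of draws from `Option β`, that is, the normalization.
  have h0 := sum_embedding_option hcard fun _ => 1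
  have h1 := sum_embedding_option hcard F
  have hL : (0 : ℝ) < Fintype.card σ := by exact_mod_cast Fintype.card_pos
  have hb : (0 : ℝ) < (Fintype.card β : ℝ) + 1 - Fintype.card σ := by
    have : (Fintype.card σ : ℝ) ≤ Fintype.card β := by exact_mod_cast hcard
    linarith
  have hne : Nonempty (σ ↪ β) := Function.Embedding.nonempty_of_card_le hcard
  have hB : (0 : ℝ) < Fintype.card (σ ↪ β) := by exact_mod_cast Fintype.card_pos
  simp only [Finset.sum_const, Finset.card_univ, nsmul_eq_mul, mul_one] at h0
  rw [Fintype.card_prod] at h0 ⊢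
  push_cast at h0 ⊢
  have hA : (Fintype.card (σ ↪ Option β) : ℝ) =
      (Fintype.card β + 1) * Fintype.card (σ ↪ β) /
        ((Fintype.card β : ℝ) + 1 - Fintype.card σ) := by
    rw [eq_div_iff hb.ne', mul_comm, h0]
    ring
  have hS : ∑ e, F e = ∑ d : σ ↪ β, F (d.trans Function.Embedding.some) +
      (∑ k : σ × (σ ↪ β), F (replaceByNone k.1 k.2)) /
        ((Fintype.card β : ℝ) + 1 - Fintype.card σ) := by
    rw [eq_comm, ← sub_eq_zero]
    field_simp
    linarith
  rw [hA, hS, hg]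
  field_simp

end Draws

/-! ### Laws computed from a uniform draw -/

section DrawLaw

variable {σ Z Ω : Type*} [MeasurableSpace Ω]

/-- The law obtained by applying `G` to the contents of a uniform draw from `T`. -/
def drawLaw (G : (σ → Z) → Measure Ω) {T : Type*} [Fintype (σ ↪ T)] (c : T → Z) : Measure Ω :=
  (Fintype.card (σ ↪ T) : ℝ≥0∞)⁻¹ • ∑ d : σ ↪ T, G fun s => c (d s)

variable (G : (σ → Z) → Measure Ω)

lemma drawLaw_congr {T T' : Type*} [Fintype (σ ↪ T)] [Fintype (σ ↪ T')] (e : T ≃ T') {c : T → Z}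
    {c' : T' → Z} (h : ∀ x, c x = c' (e x)) : drawLaw G c = drawLaw G c' := by
  unfold drawLaw
  let E : (σ ↪ T) ≃ (σ ↪ T') := Equiv.embeddingCongr (Equiv.refl σ) e
  rw [Fintype.card_congr E]
  congr 1
  refine Fintype.sum_equiv E _ _ fun d => ?_
  congr 1
  ext1 s
  simp [E, h]

variable [∀ g, IsProbabilityMeasure (G g)]

lemma isProbabilityMeasure_drawLaw {T : Type*} [Fintype (σ ↪ T)] [Nonempty (σ ↪ T)] (c : T → Z) :
    IsProbabilityMeasure (drawLaw G c) := by
  constructor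
  rw [drawLaw]
  simp only [Measure.smul_apply, Measure.coe_finsetSum, Finset.sum_apply, measure_univ,
    Finset.sum_const, Finset.card_univ, nsmul_eq_mul, mul_one, smul_eq_mul]
  exact ENNReal.inv_mul_cancel (by simp [Fintype.card_ne_zero]) (by simp)

lemma drawLaw_real {T : Type*} [Fintype (σ ↪ T)] (c : T → Z) (A : Set Ω) :
    (drawLaw G c).real A =
      (Fintype.card (σ ↪ T) : ℝ)⁻¹ * ∑ d : σ ↪ T, (G fun s => c (d s)).real A := by
  rw [drawLaw, measureReal_ennreal_smul_apply, Measure.real, Measure.finsetSum_apply,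
    ENNReal.toReal_sum fun d _ => measure_ne_top _ _]
  simp [Measure.real]

/-- The law computed from a draw from a population with contents `c`, to which the element `z` is
added if `m = some z`. -/
def drawLawOption {β : Type*} [Fintype (σ ↪ β)] [Fintype (σ ↪ Option β)] (c : β → Z) :
    Option Z → Measure Ω
  | none => drawLaw G c
  | some z => drawLaw G fun o : Option β => o.elim z c

/-- The contents of a draw, with slot `s` replaced by `z` if `m = some z`. -/
def replaceSlot [DecidableEq σ] (m : Option Z) (s : σ) (f : σ → Z) : σ → Z :=
  m.elim f (Function.update f s)

lemma replaceSlot_of_ne [DecidableEq σ] (m : Option Z) {s x : σ} (h : x ≠ s) (f : σ → Z) :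
    replaceSlot m s f x = f x := by
  cases m with
  | none => rfl
  | some z => exact Function.update_of_ne h _ _

variable [Fintype σ] [DecidableEq σ] {β : Type*} [Fintype β] [DecidableEq β]

/-- One formula with or without an extra element: if `m = none`, both mixtures coincide. Adding,
removing and replacing an element are thus treated together, and the `1 - g` parts cancel in a
difference. -/
lemma drawLawOption_real [Nonempty σ] (hcard : Fintype.card σ ≤ Fintype.card β) (c : β → Z)
    (m : Option Z) (A : Set Ω) {g : ℝ} (hg : g = Fintype.card σ / (Fintype.card β + 1)) :
    (drawLawOption G c m).real A =
      (1 - g) * ∑ k : σ × (σ ↪ β), (Fintype.card (σ × (σ ↪ β)) : ℝ)⁻¹ *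
        (G fun s => c (k.2 s)).real A +
      g * ∑ k : σ × (σ ↪ β), (Fintype.card (σ × (σ ↪ β)) : ℝ)⁻¹ *
        (G (replaceSlot m k.1 fun s => c (k.2 s))).real A := by
  have hL : (Fintype.card σ : ℝ) ≠ 0 := by exact_mod_cast Fintype.card_ne_zero
  have h0 : ∑ k : σ × (σ ↪ β), (Fintype.card (σ × (σ ↪ β)) : ℝ)⁻¹ *
      (G fun s => c (k.2 s)).real A =
      (Fintype.card (σ ↪ β) : ℝ)⁻¹ * ∑ d : σ ↪ β, (G fun s => c (d s)).real A := by
    rw [← Finset.mul_sum, Fintype.card_prod]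
    simp only [Fintype.sum_prod_type, Finset.sum_const, Finset.card_univ, nsmul_eq_mul]
    push_cast
    rw [mul_inv, mul_mul_mul_comm, inv_mul_cancel₀ hL, one_mul]
  cases m with
  | none =>
    rw [show (fun k : σ × (σ ↪ β) => (Fintype.card (σ × (σ ↪ β)) : ℝ)⁻¹ *
        (G (replaceSlot none k.1 fun s => c (k.2 s))).real A) = fun k =>
        (Fintype.card (σ × (σ ↪ β)) : ℝ)⁻¹ * (G fun s => c (k.2 s)).real A from rfl, h0,
      drawLawOption, drawLaw_real]
    ring
  | some z =>
    rw [h0, drawLawOption, drawLaw_real, average_embedding_option hcard _ hg, ← Finset.mul_sum]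
    congr 3
    refine Finset.sum_congr rfl fun k _ => ?_
    congr 2
    ext1 s
    by_cases hs : s = k.1
    · rw [hs, replaceByNone_self]
      simp [replaceSlot]
    · rw [replaceByNone_of_ne hs, replaceSlot_of_ne _ hs]
      rfl

variable [Fintype Ω] [MeasurableSingletonClass Ω]

/-- Drawing without replacement amplifies Rényi bounds. The two populations arise from a common
one by adding at most one element each. -/
theorem renyiLE_drawLawOption [Nonempty σ] (c : β → Z) (m m' : Option Z) {n₀ : ℕ}
    (hn₀ : Fintype.card σ ≤ n₀) (hm : n₀ ≤ Fintype.card β + if m.isSome then 1 else 0)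
    (hm' : n₀ ≤ Fintype.card β + if m'.isSome then 1 else 0) {τ : ℕ → ℝ} (hτ : 0 ≤ τ 2)
    (hG : ∀ j : ℕ, 2 ≤ j → ∀ (f f' : σ → Z) (s : σ), (∀ x, x ≠ s → f x = f' x) →
      RenyiLE j (τ j) (G f) (G f')) {α : ℕ} (hα : 2 ≤ α)
    [IsProbabilityMeasure (drawLawOption G c m)] [IsProbabilityMeasure (drawLawOption G c m')] :
    RenyiLE α (subsampledRDP (Fintype.card σ / n₀) τ α) (drawLawOption G c m)
      (drawLawOption G c m') := by
  have hL : 0 < Fintype.card σ := Fintype.card_pos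
  have hn₀0 : (0 : ℝ) < n₀ := by exact_mod_cast hL.trans_le hn₀
  rcases le_or_gt (Fintype.card σ) (Fintype.card β) with hcard | hcard
  · obtain ⟨g, hg⟩ : ∃ g : ℝ, g = Fintype.card σ / (Fintype.card β + 1) := ⟨_, rfl⟩
    have hg0 : 0 ≤ g := by rw [hg]; positivity
    have hcard' : (Fintype.card σ : ℝ) ≤ Fintype.card β := by exact_mod_cast hcard
    have hg1 : g ≤ 1 := by
      rw [hg, div_le_one (by positivity)]
      linarith
    have hgγ : g ≤ Fintype.card σ / n₀ := by
      rw [hg]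
      gcongr
      have : n₀ ≤ Fintype.card β + 1 := hm.trans (by split_ifs <;> omega)
      exact_mod_cast this
    have hne : Nonempty (σ ↪ β) := Function.Embedding.nonempty_of_card_le hcard
    have hwg : ENNReal.ofReal (1 - g) + ENNReal.ofReal g = 1 := by
      rw [← ENNReal.ofReal_add (by linarith) hg0]
      simp
    -- The reference law mixes the unmodified draw with the draw modified by `m'`. Both components
    -- have contents differing from those behind `p k` and `q k` in at most slot `k.1`, so convexity
    -- gives the Rényi bounds.
    set r : σ × (σ ↪ β) → Measure Ω := fun k =>
      ENNReal.ofReal (1 - g) • G (fun s => c (k.2 s)) +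
        ENNReal.ofReal g • G (replaceSlot m' k.1 fun s => c (k.2 s)) with hr
    have hrP : ∀ k, IsProbabilityMeasure (r k) := fun k => ⟨by simp [hr, hwg]⟩
    have hkey : ∀ j : ℕ, 2 ≤ j → ∀ (m'' : Option Z) (k : σ × (σ ↪ β)),
        RenyiLE j (τ j) (G (replaceSlot m'' k.1 fun s => c (k.2 s))) (r k) := by
      intro j hj m'' k
      have hsum : ∑ i : Fin 2, ![ENNReal.ofReal (1 - g), ENNReal.ofReal g] i = 1 := by
        simpa using hwg
      have := RenyiLE.sum_smul (a := j) (τ := τ j) (by exact_mod_cast hj) hsum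
        (m := fun _ => G (replaceSlot m'' k.1 fun s => c (k.2 s)))
        (m' := ![G (fun s => c (k.2 s)), G (replaceSlot m' k.1 fun s => c (k.2 s))]) (by
          intro i
          fin_cases i
          · exact hG j hj _ _ k.1 fun x hx => replaceSlot_of_ne _ hx _
          · exact hG j hj _ _ k.1 fun x hx =>
              (replaceSlot_of_ne _ hx _).trans
                (replaceSlot_of_ne m' hx fun s => c (k.2 s)).symm)
      rwa [← Finset.sum_smul, hsum, one_smul, Fin.sum_univ_two] at this
    refine RenyiLE.subsample (κ := σ × (σ ↪ β)) (w := fun _ => (Fintype.card (σ × (σ ↪ β)) : ℝ)⁻¹)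
      (p := fun k => G (replaceSlot m k.1 fun s => c (k.2 s)))
      (q := fun k => G (replaceSlot m' k.1 fun s => c (k.2 s))) (r := r)
      (fun _ => by positivity) ?_ hg0 hgγ ?_ ?_ hτ hα (fun j hj => hkey j hj m)
      (fun j hj => hkey j hj m')
    · rw [Finset.sum_const, Finset.card_univ, nsmul_eq_mul, mul_inv_cancel₀]
      exact_mod_cast Fintype.card_ne_zero
    · intro x
      rw [drawLawOption_real G hcard c m _ hg, drawLawOption_real G hcard c m' _ hg]
      simp_rw [mul_sub, Finset.sum_sub_distrib]
      ring
    · intro x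
      rw [drawLawOption_real G hcard c m' _ hg, Finset.mul_sum, Finset.mul_sum,
        ← Finset.sum_add_distrib]
      refine Finset.sum_congr rfl fun k _ => ?_
      rw [hr, measureReal_add_apply
        (h₁ := ENNReal.mul_ne_top ENNReal.ofReal_ne_top (measure_ne_top _ _))
        (h₂ := ENNReal.mul_ne_top ENNReal.ofReal_ne_top (measure_ne_top _ _)), measureReal_ennreal_smul_apply,
        measureReal_ennreal_smul_apply, ENNReal.toReal_ofReal hg0,
        ENNReal.toReal_ofReal (by linarith)]
      ring
  -- If `β` is too small for a draw, both datasets must contribute an extra element and the draw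
  -- exhausts the population. Then `γ = 1`, and the laws are compared draw by draw with `g = 1`.
  · obtain ⟨z, rfl⟩ : ∃ z, m = some z := by
      cases m with
      | none => simp at hm; omega
      | some z => exact ⟨z, rfl⟩
    obtain ⟨z', rfl⟩ : ∃ z', m' = some z' := by
      cases m' with
      | none => simp at hm'; omega
      | some z => exact ⟨z, rfl⟩
    simp only [Option.isSome_some, if_true] at hm
    have hn₀' : Fintype.card σ = n₀ := by omega
    have hne : Nonempty (σ ↪ Option β) :=
      Function.Embedding.nonempty_of_card_le (by rw [Fintype.card_option]; omega)
    have hnb : ∀ j : ℕ, 2 ≤ j → ∀ (y : Z) (e : σ ↪ Option β), RenyiLE j (τ j)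
        (G fun s => (e s).elim y c) (G fun s => (e s).elim z' c) := by
      intro j hj y e
      by_cases he : ∃ s, e s = none
      · obtain ⟨s, hs⟩ := he
        refine hG j hj _ _ s fun x hx => ?_
        cases hex : e x with
        | none => exact absurd (e.injective (hex.trans hs.symm)) hx
        | some v => rfl
      · refine hG j hj _ _ (Classical.arbitrary σ) fun x _ => ?_
        cases hex : e x with
        | none => exact absurd ⟨x, hex⟩ he
        | some v => rfl
    refine RenyiLE.subsample (κ := σ ↪ Option β) (g := 1)
      (w := fun _ => (Fintype.card (σ ↪ Option β) : ℝ)⁻¹)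
      (p := fun e => G fun s => (e s).elim z c) (q := fun e => G fun s => (e s).elim z' c)
      (r := fun e => G fun s => (e s).elim z' c) (fun _ => by positivity) ?_ zero_le_one ?_ ?_ ?_
      hτ hα (fun j hj => hnb j hj z) (fun j hj => hnb j hj z')
    · rw [Finset.sum_const, Finset.card_univ, nsmul_eq_mul, mul_inv_cancel₀]
      exact_mod_cast Fintype.card_ne_zero
    · rw [hn₀', div_self hn₀0.ne']
    · intro x
      rw [drawLawOption, drawLawOption, drawLaw_real, drawLaw_real, ← mul_sub, one_mul,
        ← Finset.sum_sub_distrib, Finset.mul_sum]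
    · intro x
      rw [drawLawOption, drawLaw_real, Finset.mul_sum]

end DrawLaw

/-! ### One token step -/

section TokenStep

variable {v : ℕ}

/-- The result depends only on the finite table of pairwise comparisons of coordinates. -/
lemma measurable_argmax [NeZero v] (S : Finset (Fin v)) : Measurable (argmax S) := by
  let φ : EuclideanSpace ℝ S → S × S → Bool := fun p ij => decide (p ij.1 ≤ p ij.2)
  let h : (S × S → Bool) → Fin v := fun b =>
    ((Finset.univ.filter fun j : S => ∀ i : S, b (i, j) = true).image Subtype.val).min.untopD 0
  have e : argmax S = h ∘ φ := by
    ext1 p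
    simp [argmax, h, φ]
  have hφ : Measurable φ := by
    refine measurable_pi_lambda _ fun ij => measurable_to_bool ?_
    have : (fun p : EuclideanSpace ℝ S => φ p ij) ⁻¹' {true} = {p | p ij.1 ≤ p ij.2} := by
      ext p
      simp [φ]
    rw [this]
    exact measurableSet_le (by fun_prop) (by fun_prop)
  rw [e]
  exact (measurable_of_finite h).comp hφ

/-- For `a, b` in `[0, 1]` one has `(a - b)² ≤ a + b`, and the coordinates of each vector sum to at
most 1, also when a zero denominator makes the vector zero. -/
lemma norm_rescale_sub_le (S : Finset (Fin v)) {p p' : Fin v → ℝ} (hp : ∀ i, 0 ≤ p i)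
    (hp' : ∀ i, 0 ≤ p' i) : ‖rescale S p - rescale S p'‖ ≤ √2 := by
  have h0 : ∀ {p : Fin v → ℝ}, (∀ i, 0 ≤ p i) → ∀ j : S, 0 ≤ rescale S p j := fun hp j =>
    div_nonneg (hp _) (Finset.sum_nonneg fun i _ => hp i)
  have h1 : ∀ {p : Fin v → ℝ}, (∀ i, 0 ≤ p i) → ∑ j : S, rescale S p j ≤ 1 := by
    intro p hp
    have : ∑ j : S, rescale S p j = (∑ i ∈ S, p i) / ∑ i ∈ S, p i := by
      rw [← Finset.sum_coe_sort S p, Finset.sum_div]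
      simp only [rescale, Finset.sum_coe_sort S p]
    rw [this]
    exact div_self_le_one _
  have h2 : ∀ {p : Fin v → ℝ}, (∀ i, 0 ≤ p i) → ∀ j : S, rescale S p j ≤ 1 := fun hp j =>
    (Finset.single_le_sum (fun i _ => h0 hp i) (Finset.mem_univ j)).trans (h1 hp)
  rw [EuclideanSpace.norm_eq]
  refine Real.sqrt_le_sqrt ?_
  calc ∑ j, ‖(rescale S p - rescale S p') j‖ ^ 2
      ≤ ∑ j, (rescale S p j + rescale S p' j) := by
        refine Finset.sum_le_sum fun j _ => ?_
        rw [Real.norm_eq_abs, sq_abs, PiLp.sub_apply]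
        nlinarith [h0 hp j, h0 hp' j, h2 hp j, h2 hp' j, mul_nonneg (h0 hp j) (h0 hp' j)]
    _ ≤ 2 := by
        rw [Finset.sum_add_distrib]
        linarith [h1 hp, h1 hp']

variable {X Y Prompt : Type*} [NeZero v] (LLM : Prompt → stdSimplex ℝ (Fin v))
  (PB : List (X × Y) → Y → List (Fin v) → Prompt) (P : Params) (y : Y) (tokens : List (Fin v))

/-- The law of the next token given the drawn examples. -/
def blockLaw (f : Fin P.M × Fin P.N → X × Y) : Measure (Fin v) :=
  (aggregate P fun i => rescale (reducedVocab LLM PB P.K y tokens)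
    (LLM (PB (List.ofFn fun k : Fin P.N => f (i, k)) y tokens) : Fin v → ℝ)).map
      (argmax (reducedVocab LLM PB P.K y tokens))

instance isProbabilityMeasure_blockLaw (f : Fin P.M × Fin P.N → X × Y) :
    IsProbabilityMeasure (blockLaw LLM PB P y tokens f) := by
  have := isProbabilityMeasure_aggregate P fun i => rescale (reducedVocab LLM PB P.K y tokens)
    (LLM (PB (List.ofFn fun k : Fin P.N => f (i, k)) y tokens) : Fin v → ℝ)
  exact Measure.isProbabilityMeasure_map (measurable_argmax _).aemeasurable

variable {P} in
-- A drawn example enters only the prompt of its own block, and `argmax` is post-processing.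
lemma renyiLE_blockLaw (hlam : 0 ≤ P.lam) (hσ₀ : 0 < P.σ₀) (hσ₁ : 0 < P.σ₁) (hσ₂ : 0 < P.σ₂)
    {α : ℕ} (hα : 2 ≤ α) {f f' : Fin P.M × Fin P.N → X × Y} {s : Fin P.M × Fin P.N}
    (hf : ∀ x, x ≠ s → f x = f' x) :
    RenyiLE α (stepRDP P α) (blockLaw LLM PB P y tokens f) (blockLaw LLM PB P y tokens f') := by
  refine (renyiLE_aggregate (i₀ := s.1) hlam hσ₀ hσ₁ hσ₂ hα (fun i hi => ?_) ?_).map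
    (measurable_argmax _)
  · have : (fun k : Fin P.N => f (i, k)) = fun k => f' (i, k) :=
      funext fun k => hf _ fun h => hi (congrArg Prod.fst h)
    rw [this]
  · exact norm_rescale_sub_le _ (LLM _).2.1 (LLM _).2.1

variable [DecidableEq Y] {n : ℕ}

lemma tokenStep_eq_drawLaw (D : Fin n → X × Y) : tokenStep LLM PB P D y tokens =
    drawLaw (blockLaw LLM PB P y tokens) fun i : {i : Fin n // (D i).2 = y} => D i := rfl

/-- Entry `i₀` joins the population exactly when it carries the label `y`. The rest is expressed
through `D₀`, so that two neighbors, both compared with the same `D₀`, share one index type and one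
content map. -/
lemma drawLaw_eq_drawLawOption {Ω σ : Type*} [MeasurableSpace Ω] [Fintype σ] [DecidableEq σ]
    (G : (σ → X × Y) → Measure Ω) {D D₀ : Fin n → X × Y} {i₀ : Fin n}
    (h : ∀ j, j ≠ i₀ → D j = D₀ j) {n₀ : ℕ}
    (hn₀ : n₀ ≤ (Finset.univ.filter fun i => (D i).2 = y).card) :
    ∃ m : Option (X × Y),
      n₀ ≤ Fintype.card {i // i ≠ i₀ ∧ (D₀ i).2 = y} + (if m.isSome then 1 else 0) ∧
      drawLaw G (fun i : {i : Fin n // (D i).2 = y} => D i) =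
        drawLawOption G (fun i : {i // i ≠ i₀ ∧ (D₀ i).2 = y} => D₀ i) m := by
  rw [← Fintype.card_subtype] at hn₀
  by_cases hy : (D i₀).2 = y
  · let e : {i : Fin n // (D i).2 = y} ≃ Option {i // i ≠ i₀ ∧ (D₀ i).2 = y} :=
      { toFun := fun i => if hi : i.1 = i₀ then none else some ⟨i.1, hi, by rw [← h _ hi]; exact i.2⟩
        invFun := fun o => o.elim ⟨i₀, hy⟩ fun i => ⟨i.1, by rw [h _ i.2.1]; exact i.2.2⟩
        left_inv := by
          rintro ⟨i, hi⟩
          by_cases hii : i = i₀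
          · subst hii; simp
          · simp [hii]
        right_inv := by
          rintro (_ | ⟨i, hi, hi'⟩)
          · simp
          · simp [hi] }
    refine ⟨some (D i₀), ?_, ?_⟩
    · rw [Fintype.card_congr e, Fintype.card_option] at hn₀
      simpa using hn₀
    · rw [drawLawOption]
      refine drawLaw_congr G e ?_
      rintro ⟨i, hi⟩
      by_cases hii : i = i₀
      · subst hii; simp [e]
      · simp [e, hii, h i hii]
  · let e : {i : Fin n // (D i).2 = y} ≃ {i // i ≠ i₀ ∧ (D₀ i).2 = y} :=
      Equiv.subtypeEquivRight fun i => by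
        constructor
        · intro hi
          have hii : i ≠ i₀ := by rintro rfl; exact hy hi
          exact ⟨hii, by rw [← h i hii]; exact hi⟩
        · rintro ⟨hii, hi⟩
          rw [h i hii]
          exact hi
    refine ⟨none, ?_, ?_⟩
    · rw [Fintype.card_congr e] at hn₀
      simpa using hn₀
    · rw [drawLawOption]
      exact drawLaw_congr G e fun i => h i.1 (e i).2.1

variable {n₀ : ℕ}

lemma isProbabilityMeasure_tokenStep (hn₀ : P.M * P.N ≤ n₀) (D : Dataset X Y n y n₀) :
    IsProbabilityMeasure (tokenStep LLM PB P D.1 y tokens) := by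
  have : Nonempty ((Fin P.M × Fin P.N) ↪ {i : Fin n // (D.1 i).2 = y}) := by
    refine Function.Embedding.nonempty_of_card_le ?_
    rw [Fintype.card_prod, Fintype.card_fin, Fintype.card_fin, Fintype.card_subtype]
    exact hn₀.trans D.2
  rw [tokenStep_eq_drawLaw]
  exact isProbabilityMeasure_drawLaw _ _

variable {P y}

lemma renyiLE_tokenStep (hM : 1 ≤ P.M) (hN : 1 ≤ P.N) (hlam : 0 ≤ P.lam) (hσ₀ : 0 < P.σ₀)
    (hσ₁ : 0 < P.σ₁) (hσ₂ : 0 < P.σ₂) (hn₀ : P.M * P.N ≤ n₀) {α : ℕ} (hα : 2 ≤ α)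
    {D D' : Dataset X Y n y n₀} (h : Neighbor D D') :
    RenyiLE α (subsampledRDP ((P.M * P.N : ℕ) / n₀) (stepRDP P) α)
      (tokenStep LLM PB P D.1 y tokens) (tokenStep LLM PB P D'.1 y tokens) := by
  have hP := isProbabilityMeasure_tokenStep LLM PB P y tokens hn₀ D
  have hP' := isProbabilityMeasure_tokenStep LLM PB P y tokens hn₀ D'
  obtain ⟨i₀, hi₀⟩ := h
  obtain ⟨m, hm, e⟩ := drawLaw_eq_drawLawOption y (blockLaw LLM PB P y tokens) hi₀ D.2
  obtain ⟨m', hm', e'⟩ := drawLaw_eq_drawLawOption y (blockLaw LLM PB P y tokens)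
    (D := D'.1) (D₀ := D'.1) (i₀ := i₀) (fun _ _ => rfl) D'.2
  rw [tokenStep_eq_drawLaw] at hP hP' ⊢
  rw [tokenStep_eq_drawLaw]
  rw [e] at hP ⊢
  rw [e'] at hP' ⊢
  have hcard : Fintype.card (Fin P.M × Fin P.N) = P.M * P.N := by simp
  have : Nonempty (Fin P.M × Fin P.N) := ⟨⟨0, hM⟩, ⟨0, hN⟩⟩
  rw [← hcard] at hn₀ ⊢
  exact renyiLE_drawLawOption _ _ _ _ hn₀ hm hm' (stepRDP_nonneg P 2)
    (fun j hj f f' s hf => renyiLE_blockLaw LLM PB y tokens hlam hσ₀ hσ₁ hσ₂ hj hf) hα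

/-! ### The token sequence -/

lemma isProbabilityMeasure_generate (hn₀ : P.M * P.N ≤ n₀) (D : Dataset X Y n y n₀) (T : ℕ) :
    IsProbabilityMeasure (generate LLM PB P D.1 y T tokens) := by
  induction T generalizing tokens with
  | zero => rw [generate]; infer_instance
  | succ T ih =>
    have := isProbabilityMeasure_tokenStep LLM PB P y tokens hn₀ D
    rw [generate]
    exact isProbabilityMeasure_bind' Measurable.of_discrete fun w => ih _

/-- The one-step bound is uniform in the tokens generated so far, so adaptive composition adds it
`T` times. -/
lemma renyiLE_generate (hM : 1 ≤ P.M) (hN : 1 ≤ P.N) (hlam : 0 ≤ P.lam) (hσ₀ : 0 < P.σ₀)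
    (hσ₁ : 0 < P.σ₁) (hσ₂ : 0 < P.σ₂) (hn₀ : P.M * P.N ≤ n₀) {α : ℕ} (hα : 2 ≤ α)
    {D D' : Dataset X Y n y n₀} (h : Neighbor D D') (T : ℕ) :
    RenyiLE α (T * subsampledRDP ((P.M * P.N : ℕ) / n₀) (stepRDP P) α)
      (generate LLM PB P D.1 y T tokens) (generate LLM PB P D'.1 y T tokens) := by
  induction T generalizing tokens with
  | zero =>
    rw [generate, generate]
    exact RenyiLE.refl (by exact_mod_cast hα) (by simp) _
  | succ T ih =>
    rw [generate, generate]
    refine ((renyiLE_tokenStep LLM PB tokens hM hN hlam hσ₀ hσ₁ hσ₂ hn₀ hα h).bind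
      Measurable.of_discrete Measurable.of_discrete
      (Filter.Eventually.of_forall fun w => ih _)).mono (le_of_eq ?_)
    push_cast
    ring

end TokenStep

end AdaDPSyn

end

/-! ### The privacy guarantee -/

theorem theorem1 {X Y Prompt : Type*} [DecidableEq Y] {v : ℕ} [NeZero v]
    (LLM : Prompt → stdSimplex ℝ (Fin v)) (PB : List (X × Y) → Y → List (Fin v) → Prompt)
    (P : AdaDPSyn.Params) (hM : 1 ≤ P.M) (hN : 1 ≤ P.N) (hK : 1 ≤ P.K) (hKv : P.K ≤ v)
    (hρ : 0 < P.ρ) (hρ' : P.ρ ≤ 1) (hlam : 0 ≤ P.lam) (hθ : 0 < P.θ)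
    (hσ₀ : 0 < P.σ₀) (hσ₁ : 0 < P.σ₁) (hσ₂ : 0 < P.σ₂)
    (n n₀ : ℕ) (y : Y) (hn₀ : P.M * P.N ≤ n₀) :
    (∀ D : AdaDPSyn.Dataset X Y n y n₀, IsProbabilityMeasure (AdaDPSyn.adaDPSyn LLM PB P y D)) ∧
    ∀ α : ℕ, 2 ≤ α → ∀ δ : ℝ, 0 < δ → δ < 1 →
      AdaDPSyn.IsDP (AdaDPSyn.Neighbor (X := X) (n := n) (y := y) (n₀ := n₀))
        (AdaDPSyn.adaDPSyn LLM PB P y) (AdaDPSyn.epsilon P n₀ α δ) δ := by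
  refine ⟨fun D => AdaDPSyn.isProbabilityMeasure_generate LLM PB [] hn₀ D _,
    fun α hα δ hδ _ D D' h S hS => ?_⟩
  have := AdaDPSyn.isProbabilityMeasure_generate LLM PB [] hn₀ D P.Tmax
  have := AdaDPSyn.isProbabilityMeasure_generate LLM PB [] hn₀ D' P.Tmax
  exact (AdaDPSyn.renyiLE_generate LLM PB [] hM hN hlam hσ₀ hσ₁ hσ₂ hn₀ hα h P.Tmax).measure_le
    hα hδ le_rfl hS
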